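/- **Setting.** All graphs are simple, on node set $\{0,\dots,m-1\}$ with $m\le n$; here $n$ is the size parameter (the number of nodes of the original graph) and $m=n_G\ge 1$ is the number of nodes of the current graph $G$. A *word* is a natural number that is polynomial in $n$ ($O(\log n)$ bits). A *graph problem* $\mathcal P$ specifies which assignments $\mathrm{IN}$ of word lists to the nodes of a graph are valid inputs, and which assignments of word lists are valid output labellings. An *$r$-round LOCAL algorithm* determines the result at a node $v$ from the $r$-hop neighbourhood of $v$ (identifiers, edges, and data stored there), with unbounded computation. $\mathcal P$ is *self-reducible* if for some constant $r$ there is an $r$-round LOCAL algorithm such that, for every graph $G$ with valid input $\mathrm{IN}$, every valid output labelling $L$ and every $S\subseteq V(G)$, the nodes of $S$ compute from $\mathrm{IN}$, $S$ and the labels $L|_{V\setminus S}$ new inputs $\widehat{\mathrm{IN}}$ such that $(G[S],\widehat{\mathrm{IN}})$ is a valid instance, and replacing $L$ on $S$ by any valid output labelling of this instance gives a valid output labelling of $(G,\mathrm{IN})$. *MPC.* In each round every machine performs an arbitrary deterministic local computation on the words that it stores and sends messages to other machines. The words stored by a machine (including those just received) and the words sent by it in a round must number at most the local space $\mathfrak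 s$; the global space is $\mathfrak s$ times the number of machines. At the start a dedicated machine of each node $v$ holds the degree, the neighbours and the input of $v$; at the end it holds the output of $v$. *Procedures with deferral.* Between steps each node holds a list of words or the marker DEFER; a deferred node stays deferred. Let $\Delta\ge 1$ be an upper bound on the maximum degree and $\tau\ge1$. A randomized LOCAL procedure, run on $G$ with node information $x$, is a *normal $(\tau,\Delta)$-round distributed procedure* if * the node information and the outputs consist of $O(\Delta^{\tau})$ words, and each node has $O(\Delta^{2\tau})$ independent uniform random bits; * the output $\mathrm{OUT}_v$ depends only on the information and random bits in the $\tau$-hop neighbourhood of $v$ (with no restriction on the local computation; in particular $O(\Delta^{8\tau})$ computation is allowed); * there are strong and weak success properties $\mathrm{SSP}_v$, $\mathrm{WSP}_v$, each a function of the $\tau$-hop neighbourhood of $v$ and the outputs (or DEFER markers) in it; * every non-deferred node $v$ satisfies $\mathrm{SSP}_v$ with probability at least $1-\frac1{2m}$; * for all values of the random bits: if the nodes violating SSP are deferred, then every other participating node satisfies WSP. *Algorithms.* For $\delta\in(0,1)$ put $\Delta=n^{7\delta}$. A randomized algorithm $\mathcal A$ for $\mathcal P$ is, for each $n$ and $m$,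 a series of at most $k=k(n)\geq 1$ normal $(\tau,\Delta)$-round procedures, $\tau=\tau(n)\ge1$, and of up to $O(k\tau+\log^* m)$ deterministic steps. These are LOCAL rounds whose results have $O(\Delta^\tau)$ words, and MPC rounds, in blocks whose results have $O(\Delta^\tau)$ words, on $O(m)$ machines with local space $O(n^{7\delta\tau C})$. It is run on the valid instances with maximum degree at most $\Delta$ and inputs of $O(\Delta^\tau)$ words per node, each step on the information left by the previous one. The requirements on a step hold for all information to which the previous steps can lead, where a procedure may lead to any of its outcomes with any set of nodes then deferred, provided that all non-deferred nodes satisfy its weak success property. Finally, in all situations that can be reached at the end, the labels held by the non-deferred nodes extend to a valid output labelling of the instance. **Theorem.** There is a constant $C$ such that for every $\delta\in(0,1)$, every self-reducible problem $\mathcal P$ and every randomized algorithm $\mathcal A$ for $\mathcal P$ as above (for these $\delta$ and $C$) that consists of $k=n^{o(1)}$ normal $(\tau,n^{7\delta})$-round distributed procedures and of up to $O(k\tau+\log^* n_G)$ deterministic LOCAL or MPC steps within the stated space bounds, $\mathcal A$ can be derandomized: there is a deterministic MPC algorithm which, on every valid instance $G$ of $\mathcal P$ with $n_G\le n$ nodes,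 maximum degree at most $n^{7\delta}$ and inputs of $O(n^{7\delta\tau})$ words per node, uses $O(k\tau+\log^* n_G)$ rounds, local space $O(n^{7\delta\tau C})$ per machine and global space $O(n_G\cdot n^{7\delta\tau C})$, and in which all nodes together give a valid output for $\mathcal P$. -/

import Mathlib

/-- The iterated logarithm (base 2). -/
noncomputable def logStar (n : ℕ) : ℕ :=
  if h : n ≤ 1 then 0 else logStar (Nat.log 2 n) + 1
termination_by n
decreasing_by exact Nat.log_lt_self 2 (by omega)

/-! ### The LOCAL model

Nodes of an `m`-node graph carry the identifiers `0, …, m - 1`.  An `r`-round LOCAL algorithm maps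
the `r`-hop neighbourhood of a node (identifiers, edges and the data stored there) to the result of
that node; messages and local computation are unbounded. -/

/-- The `r`-hop neighbourhoods of `v` in `(G, x)` and in `(G', x')` coincide. -/
def AgreeNear {m : ℕ} {α : Type} (r : ℕ) (G G' : SimpleGraph (Fin m)) (x x' : Fin m → α)
    (v : Fin m) : Prop :=
  (∀ u, G.edist v u ≤ r ↔ G'.edist v u ≤ r) ∧
  (∀ u w, G.edist v u ≤ r → G.edist v w ≤ r → (G.Adj u w ↔ G'.Adj u w)) ∧
  (∀ u, G.edist v u ≤ r → x u = x' u)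

/-- `f G x v`, the result at node `v` on the graph `G` with node data `x`, is a function of the
`r`-hop neighbourhood of `v`. -/
def IsLocal {m : ℕ} {α β : Type} (r : ℕ)
    (f : SimpleGraph (Fin m) → (Fin m → α) → Fin m → β) : Prop :=
  ∀ G G' x x' v, AgreeNear r G G' x x' v → f G x v = f G' x' v

/-! ### Graph problems and self-reducibility -/

/-- A graph problem: every node gets an input (a list of words) and has to produce an output label
(a list of words).  `IsInstance G IN` says that `IN` is a valid input on `G`, and
`IsSolution G IN L` that `L` is a valid output labelling. -/
structure GraphProblem where
  IsInstance : ∀ {m : ℕ}, SimpleGraph (Fin m) → (Fin m → List ℕ) → Prop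
  IsSolution : ∀ {m : ℕ}, SimpleGraph (Fin m) → (Fin m → List ℕ) → (Fin m → List ℕ) → Prop

open Classical in
/-- What the nodes know when new inputs for `S = range e` are computed: all inputs, the set `S`, and
the output labels outside `S` (the labels inside `S` are the ones to be replaced). -/
noncomputable def partialView {m s : ℕ} (IN L : Fin m → List ℕ) (e : Fin s ↪ Fin m) :
    Fin m → List ℕ × Option (List ℕ) :=
  fun u => (IN u, if u ∈ Set.range e then none else some (L u))

/-- Self-reducibility.  The subset `S` is the range of `e`, whose nodes are enumerated by `e`;
`G.comap e` is the graph induced on `S`, and `Function.extend e L' L` is the labelling `L` with the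
labels on `S` replaced by those of `L'`. -/
def GraphProblem.SelfReducible (P : GraphProblem) : Prop :=
  ∃ (r : ℕ) (R : ∀ m : ℕ, SimpleGraph (Fin m) → (Fin m → List ℕ × Option (List ℕ)) →
      Fin m → List ℕ),
    (∀ m, IsLocal r (R m)) ∧
    ∀ (m : ℕ) (G : SimpleGraph (Fin m)) (IN L : Fin m → List ℕ),
      P.IsInstance G IN → P.IsSolution G IN L →
      ∀ (s : ℕ) (e : Fin s ↪ Fin m),
        P.IsInstance (G.comap e) (fun i => R m G (partialView IN L e) (e i)) ∧
        ∀ L' : Fin s → List ℕ,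
          P.IsSolution (G.comap e) (fun i => R m G (partialView IN L e) (e i)) L' →
          P.IsSolution G IN (Function.extend e L' L)

/-! ### The MPC model -/

/-- A deterministic MPC algorithm for `m`-node graphs, with `machines ≥ m` machines, that runs for
`rounds` rounds.  What a machine stores at the start of a round is the pair of the words it has kept
and the message it has just received from each machine (the empty list if there was none).
In round `t` machine `i` performs an arbitrary local computation `step t i`, whose result is the list
of words that it keeps and the message that it sends to each machine. -/
structure MPC (m : ℕ) where
  machines : ℕ
  le_machines : m ≤ machines
  rounds : ℕ
  step : ℕ → Fin machines → List ℕ × (Fin machines → List ℕ) →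
    List ℕ × (Fin machines → List ℕ)

/-- The contents of the machines after `t` rounds: at the start machine `v` holds `inp v`, for every
node `v`, and the remaining machines are empty. -/
def MPC.conf {m : ℕ} (B : MPC m) (inp : Fin m → List ℕ) :
    ℕ → Fin B.machines → List ℕ × (Fin B.machines → List ℕ)
  | 0 => fun i => (if h : (i : ℕ) < m then inp ⟨i, h⟩ else [], fun _ => [])
  | t + 1 => fun i =>
      ((B.step t i (B.conf inp t i)).1, fun j => (B.step t j (B.conf inp t j)).2 i)

/-- The output at node `v`: the words kept by machine `v` at the end. -/
def MPC.output {m : ℕ} (B : MPC m) (inp : Fin m → List ℕ) (v : Fin m) : List ℕ :=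
  (B.conf inp B.rounds (Fin.castLE B.le_machines v)).1

/-- At all times every machine stores at most `s` words (those just received included), every machine
has sent at most `s` words in the last round, and all words are less than `W`. -/
def MPC.FitsSpace {m : ℕ} (B : MPC m) (inp : Fin m → List ℕ) (s W : ℕ) : Prop :=
  ∀ t ≤ B.rounds, ∀ i : Fin B.machines,
    (B.conf inp t i).1.length + ∑ j, ((B.conf inp t i).2 j).length ≤ s ∧
    ∑ j, ((B.conf inp t j).2 i).length ≤ s ∧
    (∀ w ∈ (B.conf inp t i).1, w < W) ∧
    ∀ j, ∀ w ∈ (B.conf inp t i).2 j, w < W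

/-! ### Distributed procedures with deferral -/

/-- The information held by the nodes of an `m`-node graph between two steps of an algorithm; `none`
is the marker DEFER. -/
abbrev State (m : ℕ) := Fin m → Option (List ℕ)

open Classical in
/-- The words initially on the machine of node `v`: the degree of `v`, the neighbours of `v`, and the
information of `v` (preceded by `1`, or just `0` if `v` is deferred). -/
noncomputable def nodeInput {m : ℕ} (G : SimpleGraph (Fin m)) (x : State m) (v : Fin m) : List ℕ :=
  let nbrs : List ℕ := ((List.finRange m).filter (fun u => G.Adj v u)).map Fin.val
  nbrs.length :: nbrs ++ (match x v with
    | none => [0]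
    | some a => 1 :: a)

/-- A randomized distributed procedure on `m` nodes: the number of random bits of a node, the output
of a node (as a function of the graph, and of the information and the random bits of all nodes), and
the strong and the weak success property of a node (as functions of the graph and of the outputs).
Nodes may have been deferred by earlier procedures, so both success properties are evaluated on
outputs extended by DEFER. -/
structure RandProc (m : ℕ) where
  bits : ℕ
  out : SimpleGraph (Fin m) → (Fin m → Option (List ℕ) × (Fin bits → Bool)) → Fin m → List ℕ
  ssp : SimpleGraph (Fin m) → State m → Fin m → Prop
  wsp : SimpleGraph (Fin m) → State m → Fin m → Prop

/-- The outcome of the procedure on information `x` with random bits `ρ`; nodes that were deferred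
before stay deferred. -/
def RandProc.run {m : ℕ} (p : RandProc m) (G : SimpleGraph (Fin m)) (x : State m)
    (ρ : Fin m → Fin p.bits → Bool) : State m :=
  fun v => (x v).map fun _ => p.out G (fun u => (x u, ρ u)) v

open Classical in
/-- Defer the nodes of `D`. -/
noncomputable def defer {m : ℕ} (y : State m) (D : Set (Fin m)) : State m :=
  fun v => if v ∈ D then none else y v

/-- One step of an algorithm: a randomized procedure, a deterministic LOCAL round, or a block of
deterministic MPC rounds. -/
inductive Step (m : ℕ) where
  | rand (p : RandProc m)
  | loc (f : SimpleGraph (Fin m) → State m → Fin m → List ℕ)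
  | mpc (B : MPC m)

/-- The step may lead from `x` to `y`.  For a randomized procedure, `y` is an outcome for some random
bits in which some nodes are then deferred and all non-deferred nodes satisfy the weak success
property.  Deterministic steps are run as they are. -/
def Step.Trans {m : ℕ} (G : SimpleGraph (Fin m)) (x y : State m) : Step m → Prop
  | .rand p => ∃ (ρ : Fin m → Fin p.bits → Bool) (D : Set (Fin m)),
      y = defer (p.run G x ρ) D ∧ ∀ v, y v ≠ none → p.wsp G y v
  | .loc f => y = fun v => (x v).map fun _ => f G x v
  | .mpc B => y = fun v => (x v).map fun _ => B.output (nodeInput G x) v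

/-- The series of steps may lead from `x` to `y`. -/
def Reach {m : ℕ} (G : SimpleGraph (Fin m)) (x : State m) : List (Step m) → State m → Prop
  | [], y => y = x
  | σ :: l, y => ∃ z, σ.Trans G x z ∧ Reach G z l y

/-! ### Normal procedures and the algorithms made of them -/

/-- The parameters of an algorithm: the number `n` of nodes of the original graph, the number `τ` of
rounds of a procedure, the bound `k` on the number of procedures, the constant `c` hidden in the
`O`-notation, the constant `C` in the exponent of the space bound, and `δ`. -/
structure Params where
  n : ℕ
  τ : ℕ
  k : ℕ
  c : ℕ
  C : ℕ
  δ : ℝ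

/-- The upper bound `Δ = n ^ (7 δ)` on the maximum degree. -/
noncomputable def Params.Δ (q : Params) : ℝ := (q.n : ℝ) ^ (7 * q.δ)

/-- The space bound `n ^ (7 δ τ C)`. -/
noncomputable def Params.space (q : Params) : ℝ := (q.n : ℝ) ^ (7 * q.δ * q.τ * q.C)

/-- `G` has maximum degree at most `D`. -/
def MaxDegLE {m : ℕ} (G : SimpleGraph (Fin m)) (D : ℝ) : Prop :=
  ∀ v, ((G.neighborSet v).ncard : ℝ) ≤ D

/-- `a` consists of `O(Δ ^ τ)` words, each of `O(log n)` bits. -/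
def Params.Small (q : Params) (a : List ℕ) : Prop :=
  (a.length : ℝ) ≤ q.c * q.Δ ^ q.τ ∧ ∀ w ∈ a, w < (q.n + 2) ^ q.c

/-- The procedure `p` satisfies the conditions of a normal `(τ, Δ)`-round distributed procedure when
run on `G` with node information `x`.  No bound is put on the local computation of `p`, which makes
the class of procedures larger. -/
structure RandProc.IsNormal {m : ℕ} (p : RandProc m) (q : Params) (G : SimpleGraph (Fin m))
    (x : State m) : Prop where
  out_local : IsLocal q.τ p.out
  ssp_local : IsLocal q.τ p.ssp
  wsp_local : IsLocal q.τ p.wsp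
  bits_le : (p.bits : ℝ) ≤ q.c * q.Δ ^ (2 * q.τ)
  out_small : ∀ ρ v a, p.run G x ρ v = some a → q.Small a
  /-- Every participating node satisfies the strong success property with probability at least
  `1 - 1 / (2 m)`, over independent uniform random bits of the nodes. -/
  success : ∀ v, x v ≠ none →
    1 - 1 / (2 * (m : ℝ)) ≤
      (Nat.card {ρ : Fin m → Fin p.bits → Bool // p.ssp G (p.run G x ρ) v} : ℝ) /
        (Nat.card (Fin m → Fin p.bits → Bool) : ℝ)
  /-- If the nodes violating the strong success property are deferred, then all other participating
  nodes satisfy the weak success property. -/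
  ssp_imp_wsp : ∀ ρ v, x v ≠ none → p.ssp G (p.run G x ρ) v →
    p.wsp G (defer (p.run G x ρ) {u | ¬ p.ssp G (p.run G x ρ) u}) v

/-- The requirements on a step that is executed on `G` with node information `x`: randomized
procedures are normal, deterministic LOCAL rounds keep the information of a node small, and
deterministic MPC rounds obey the space bounds (with `O(m)` machines). -/
def Step.Good {m : ℕ} (q : Params) (G : SimpleGraph (Fin m)) (x : State m) : Step m → Prop
  | .rand p => p.IsNormal q G x
  | .loc f => IsLocal 1 f ∧ ∀ v, x v ≠ none → q.Small (f G x v)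
  | .mpc B => B.machines ≤ q.c * m ∧
      B.FitsSpace (nodeInput G x) ⌊q.c * q.space⌋₊ ((q.n + 2) ^ q.c) ∧
      ∀ v, x v ≠ none → q.Small (B.output (nodeInput G x) v)

/-- How much a step contributes to the number of randomized procedures. -/
def Step.randCount {m : ℕ} : Step m → ℕ
  | .rand _ => 1
  | .loc _ => 0
  | .mpc _ => 0

/-- How much a step contributes to the number of deterministic rounds. -/
def Step.detCount {m : ℕ} : Step m → ℕ
  | .rand _ => 0
  | .loc _ => 1
  | .mpc B => max B.rounds 1

/-- The series `A` is an algorithm for the problem `P` on `m`-node graphs of maximum degree at most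
`Δ` which consists of at most `k` normal procedures and of `O(k τ + log* m)` deterministic rounds.
Each step has to meet its requirements in every situation to which the preceding steps may lead, and
at the end the labels of the non-deferred nodes have to be part of a valid output labelling. -/
structure IsNormalAlgorithm (P : GraphProblem) (q : Params) {m : ℕ} (A : List (Step m)) : Prop where
  rand_le : (A.map Step.randCount).sum ≤ q.k
  det_le : (A.map Step.detCount).sum ≤ q.c * (q.k * q.τ + logStar m)
  good : ∀ (G : SimpleGraph (Fin m)) (IN : Fin m → List ℕ), MaxDegLE G q.Δ →
    P.IsInstance G IN → (∀ v, q.Small (IN v)) →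
    ∀ (pre post : List (Step m)) (σ : Step m), A = pre ++ σ :: post →
    ∀ x, Reach G (fun v => some (IN v)) pre x → σ.Good q G x
  final : ∀ (G : SimpleGraph (Fin m)) (IN : Fin m → List ℕ), MaxDegLE G q.Δ →
    P.IsInstance G IN → (∀ v, q.Small (IN v)) →
    ∀ y, Reach G (fun v => some (IN v)) A y →
    ∃ L, P.IsSolution G IN L ∧ ∀ v a, y v = some a → L v = a

/-!
The randomized procedures are derandomized by the method of conditional expectations, applied to a
fixed list of strings of random bits, in such a way that no node is ever deferred.

Write `Δ = n ^ (7 δ)`, and suppose first that `Δ ^ τ < n`.  Then `τ` is bounded by a constant, and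
the neighbourhood of radius `2 τ` of a node, which determines whether the outcome of a procedure
satisfies the strong success property there, is described by a number of words that is polynomial
in `Δ ^ τ`.  There are thus only `exp (poly n)` possible neighbourhoods, on each of which at most
a fraction `1 / (2 m)` of the random strings is bad.  By a Chernoff bound and a union bound, some
list of `N = poly n` strings, which does not depend on the graph, has the property that on every
neighbourhood less than `N / m` of them are bad (`exists_samples`, `exists_seeds`).  Since local
computation is free and the algorithm may depend on `n` and `m`, all machines know this list.  On a
given graph, the numbers of bad strings of the `m` nodes add up to less than `N`, so that some
string is good for all nodes at once.  The index of such a string is found digit by digit: for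
each value of the next digit, the nodes count the indices that are bad for them, the counts are
added up along a tree whose arity is about `Δ`, and a value with a small sum is chosen
(`exists_next_digit`, `exists_seed_search`).  An index has a constant number of digits to a base
of about `Δ`, and the tree has constant height, because `N` and the number of machines are
polynomial in `n` and `Δ` is a fixed power of `n`; hence a procedure takes `O(τ)` rounds
(`exists_rand_round`).  As every node satisfies the strong success property, the weak one holds
with an empty set of deferred nodes, so the simulated execution is one to which the guarantees of
the randomized algorithm apply.  Deterministic steps are simulated as they are
(`exists_local_round`, `exists_mpc_rounds`).  In the end all nodes hold labels, which therefore form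
a valid output (`derandomizable_of_bounds`).

If `Δ ^ τ ≥ n`, then a machine has room for the whole graph.  A solution made of small labels exists
because some execution of the randomized algorithm defers no node, and all machines compute the same
one (`derandomizable_of_le`).
-/

/-! ### Programs: series of MPC rounds -/

/-- The contents of `M` machines: the words kept, and the message received from each machine. -/
abbrev MConf (M : ℕ) := Fin M → List ℕ × (Fin M → List ℕ)

/-- One round of MPC: the local computation of every machine. -/
abbrev Round (M : ℕ) := Fin M → List ℕ × (Fin M → List ℕ) → List ℕ × (Fin M → List ℕ)

/-- The contents of the machines after the round `r`. -/
def Round.next {M : ℕ} (r : Round M) (c : MConf M) : MConf M :=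
  fun i => ((r i (c i)).1, fun j => (r j (c j)).2 i)

/-- The space bound `s` and the bound `W` on the words hold in the configuration `c`. -/
def Within {M : ℕ} (s W : ℕ) (c : MConf M) : Prop :=
  ∀ i, (c i).1.length + ∑ j, ((c i).2 j).length ≤ s ∧
    ∑ j, ((c j).2 i).length ≤ s ∧
    (∀ w ∈ (c i).1, w < W) ∧
    ∀ j, ∀ w ∈ (c i).2 j, w < W

/-- The rounds in the list lead from the first configuration to the second one, and the space
bounds hold all the time. -/
def Runs {M : ℕ} (s W : ℕ) : List (Round M) → MConf M → MConf M → Prop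
  | [], c, c' => c' = c ∧ Within s W c
  | r :: l, c, c' => Within s W c ∧ Runs s W l (r.next c) c'

theorem Runs.within_left {M s W : ℕ} {l : List (Round M)} {c c' : MConf M}
    (h : Runs s W l c c') : Within s W c := by
  cases l with
  | nil => exact h.2
  | cons r l => exact h.1

theorem Runs.append {M s W : ℕ} {l l' : List (Round M)} {c c' c'' : MConf M}
    (h : Runs s W l c c') (h' : Runs s W l' c' c'') : Runs s W (l ++ l') c c'' := by
  induction l generalizing c with
  | nil => obtain ⟨rfl, -⟩ := h; exact h'
  | cons r l ih => exact ⟨h.1, ih h.2⟩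

/-- The configuration in which machine `i` holds `st i` and no message is pending. -/
def quiet {M : ℕ} (st : Fin M → List ℕ) : MConf M := fun i => (st i, fun _ => [])

/-- The data of the nodes, placed on the first `m` of `M` machines. -/
def place {m : ℕ} (M : ℕ) (inp : Fin m → List ℕ) (i : Fin M) : List ℕ :=
  if h : (i : ℕ) < m then inp ⟨i, h⟩ else []

/-- The MPC algorithm that executes a series of rounds. -/
def MPC.ofRounds {m M : ℕ} (h : m ≤ M) (l : List (Round M)) : MPC m where
  machines := M
  le_machines := h
  rounds := l.length
  step t := l.getD t fun _ _ => ([], fun _ => [])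

theorem MPC.runs_drop {m M s W : ℕ} (h : m ≤ M) (l : List (Round M)) (inp : Fin m → List ℕ)
    (c' : MConf M) (hr : Runs s W l (quiet (place M inp)) c') (t : ℕ) (ht : t ≤ l.length) :
    Runs s W (l.drop t) ((MPC.ofRounds h l).conf inp t) c' := by
  induction t with
  | zero => exact hr
  | succ t ih =>
    have h1 := ih (by omega)
    rw [List.drop_eq_getElem_cons (by omega)] at h1
    have e : (MPC.ofRounds h l).conf inp (t + 1) =
        Round.next l[t] ((MPC.ofRounds h l).conf inp t) := by
      have e' : (MPC.ofRounds h l).step t = l[t] := by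
        simp only [MPC.ofRounds]
        exact List.getD_eq_getElem _ _ (by omega)
      funext i
      simp only [MPC.conf, Round.next, e']
      rfl
    rw [e]
    exact h1.2

theorem MPC.fitsSpace_of_runs {m M s W : ℕ} (h : m ≤ M) (l : List (Round M))
    (inp : Fin m → List ℕ) (c' : MConf M) (hr : Runs s W l (quiet (place M inp)) c') :
    (MPC.ofRounds h l).FitsSpace inp s W := by
  intro t ht i
  exact (MPC.runs_drop h l inp c' hr t ht).within_left i

theorem MPC.output_of_runs {m M s W : ℕ} (h : m ≤ M) (l : List (Round M))
    (inp : Fin m → List ℕ) (st : Fin M → List ℕ)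
    (hr : Runs s W l (quiet (place M inp)) (quiet st)) (v : Fin m) :
    (MPC.ofRounds h l).output inp v = st (Fin.castLE h v) := by
  have h1 := MPC.runs_drop h l inp _ hr l.length le_rfl
  rw [List.drop_length] at h1
  have h2 := h1.1
  have h3 := congrFun h2 (Fin.castLE h v)
  exact (congrArg Prod.fst h3).symm

/-- The list `l` has at most `s` words, all of them less than `W`. -/
def Bdd (s W : ℕ) (l : List ℕ) : Prop := l.length ≤ s ∧ ∀ w ∈ l, w < W

theorem Bdd.mono {s s' W W' : ℕ} {l : List ℕ} (h : Bdd s W l) (hs : s ≤ s') (hW : W ≤ W') :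
    Bdd s' W' l := ⟨h.1.trans hs, fun w hw => (h.2 w hw).trans_le hW⟩

/-- Two rounds in which the machines exchange messages and then update what they keep.  The states
of the machines are elements of `α` before and of `α'` after the superstep, stored by means of the
encodings `enc` and `enc'`. -/
noncomputable def superstep {M : ℕ} {α α' : Type} [Nonempty α] (enc : α → List ℕ)
    (enc' : α' → List ℕ) (send : Fin M → α → Fin M → List ℕ)
    (recv : Fin M → α → (Fin M → List ℕ) → α') : List (Round M) :=
  [fun i x => (x.1, send i (Function.invFun enc x.1)),
   fun i x => (enc' (recv i (Function.invFun enc x.1) x.2), fun _ => [])]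

theorem runs_superstep {M : ℕ} {α α' : Type} [Nonempty α] {enc : α → List ℕ}
    {enc' : α' → List ℕ} {send : Fin M → α → Fin M → List ℕ}
    {recv : Fin M → α → (Fin M → List ℕ) → α'} {s s₁ s₂ W : ℕ}
    (hinj : Function.Injective enc) (hs : s₁ + s₂ ≤ s) {st : Fin M → α} {st' : Fin M → α'}
    (hst' : ∀ i, recv i (st i) (fun j => send j (st j) i) = st' i)
    (h₁ : ∀ i, Bdd s₁ W (enc (st i))) (h₂ : ∀ i, ∑ j, (send i (st i) j).length ≤ s₂)
    (h₃ : ∀ i, ∑ j, (send j (st j) i).length ≤ s₂)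
    (h₄ : ∀ i j, ∀ w ∈ send i (st i) j, w < W)
    (h₅ : ∀ i, Bdd s₁ W (enc' (st' i))) :
    Runs s W (superstep enc enc' send recv) (quiet fun i => enc (st i))
      (quiet fun i => enc' (st' i)) := by
  have hd : ∀ a, Function.invFun enc (enc a) = a := Function.leftInverse_invFun hinj
  have hq : ∀ {β : Type} (e : β → List ℕ) (f : Fin M → β), (∀ i, Bdd s₁ W (e (f i))) →
      Within s W (quiet fun i => e (f i)) := by
    intro β e f hf i
    have := (hf i).1
    refine ⟨by simp only [quiet, List.length_nil, Finset.sum_const_zero]; omega,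
      by simp [quiet], (hf i).2, by simp [quiet]⟩
  refine ⟨hq _ _ h₁, ?_, ?_, ?_⟩
  · intro i
    simp only [Round.next, quiet, hd]
    refine ⟨by have := (h₁ i).1; have := h₃ i; omega, by have := h₂ i; omega, (h₁ i).2,
      fun j => h₄ j i⟩
  · funext i
    simp only [Round.next, quiet, hd, hst']
  · have := hq _ _ h₅
    convert this using 1
    funext i
    simp only [Round.next, quiet, hd, hst']

/-- A superstep without messages. -/
theorem exists_local_superstep {M : ℕ} {α α' : Type} [Nonempty α] {enc : α → List ℕ}
    (enc' : α' → List ℕ) (hinj : Function.Injective enc) (f : Fin M → α → α') (s W : ℕ) :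
    ∃ p : List (Round M), p.length = 2 ∧ ∀ (st : Fin M → α),
      (∀ i, Bdd s W (enc (st i))) → (∀ i, Bdd s W (enc' (f i (st i)))) →
      Runs s W p (quiet fun i => enc (st i)) (quiet fun i => enc' (f i (st i))) := by
  refine ⟨superstep enc enc' (fun _ _ _ => []) (fun i a _ => f i a), rfl, fun st h h' => ?_⟩
  exact runs_superstep (s₁ := s) (s₂ := 0) hinj le_rfl (fun _ => rfl) h (by simp) (by simp)
    (by simp) h'

/-! ### Encodings by lists of words -/

/-- A list of lists of words, stored as a list of words: every word is increased by one, and `0`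
ends an entry. -/
def encLists (l : List (List ℕ)) : List ℕ := l.flatMap fun a => a.map Nat.succ ++ [0]

theorem encLists_cons (a : List ℕ) (l : List (List ℕ)) :
    encLists (a :: l) = a.map Nat.succ ++ 0 :: encLists l := by
  simp [encLists]

theorem map_succ_append_zero_inj {a b x y : List ℕ}
    (h : a.map Nat.succ ++ 0 :: x = b.map Nat.succ ++ 0 :: y) : a = b ∧ x = y := by
  induction a generalizing b with
  | nil => cases b <;> simp_all
  | cons w a ih =>
    cases b with
    | nil => simp at h
    | cons u b =>
      simp only [List.map_cons, List.cons_append, List.cons.injEq, Nat.succ.injEq] at h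
      obtain ⟨h1, h2⟩ := ih h.2
      exact ⟨by rw [h.1, h1], h2⟩

theorem encLists_injective : Function.Injective encLists := by
  intro l
  induction l with
  | nil =>
    intro l' h
    cases l' with
    | nil => rfl
    | cons a l' => rw [encLists_cons] at h; simp [encLists] at h
  | cons a l ih =>
    intro l' h
    cases l' with
    | nil => rw [encLists_cons] at h; simp [encLists] at h
    | cons b l' =>
      rw [encLists_cons, encLists_cons] at h
      obtain ⟨h1, h2⟩ := map_succ_append_zero_inj h
      rw [h1, ih h2]

theorem length_encLists (l : List (List ℕ)) :
    (encLists l).length = (l.map fun a => a.length + 1).sum := by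
  simp [encLists, List.length_flatMap]

theorem bdd_encLists {s S W : ℕ} {l : List (List ℕ)} (h : ∀ a ∈ l, Bdd s W a)
    (hS : l.length * (s + 1) ≤ S) : Bdd S (W + 1) (encLists l) := by
  constructor
  · rw [length_encLists]
    refine le_trans ?_ hS
    have := List.sum_le_card_nsmul (l.map fun a => a.length + 1) (s + 1) (by
      intro x hx
      obtain ⟨a, ha, rfl⟩ := List.mem_map.1 hx
      have := (h a ha).1
      omega)
    simpa using this
  · intro w hw
    simp only [encLists, List.mem_flatMap, List.mem_append, List.mem_map, List.mem_singleton] at hw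
    obtain ⟨a, ha, ⟨u, hu, rfl⟩ | rfl⟩ := hw
    · have := (h a ha).2 u hu
      omega
    · omega

theorem Bdd.encLists_cons {s t W : ℕ} {a : List ℕ} {l : List (List ℕ)} (ha : Bdd s W a)
    (hl : Bdd t (W + 1) (encLists l)) : Bdd (s + 1 + t) (W + 1) (encLists (a :: l)) := by
  rw [_root_.encLists_cons]
  constructor
  · simp only [List.length_append, List.length_map, List.length_cons]
    have := ha.1
    have := hl.1
    omega
  · intro w hw
    simp only [List.mem_append, List.mem_map, List.mem_cons] at hw
    obtain ⟨u, hu, rfl⟩ | rfl | hw := hw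
    · have := ha.2 u hu
      omega
    · omega
    · exact hl.2 w hw

/-! ### The data of a node -/

theorem length_neighbors_le {m : ℕ} (G : SimpleGraph (Fin m)) (v : Fin m) {d : ℕ}
    (hd : (G.neighborSet v).ncard ≤ d) [DecidablePred fun u => G.Adj v u] :
    ((List.finRange m).filter (fun u => G.Adj v u)).length ≤ d := by
  classical
  refine le_trans (le_of_eq ?_) hd
  have hn : ((List.finRange m).filter (fun u => G.Adj v u)).Nodup :=
    (List.nodup_finRange m).filter _
  rw [← List.toFinset_card_of_nodup hn, ← Set.ncard_coe_finset]
  congr 1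
  ext u
  simp

/-- The list `l = nodeInput G x v` with the information of the node replaced by `o`. -/
def setInfo (l : List ℕ) (o : Option (List ℕ)) : List ℕ :=
  l.take (l.headD 0 + 1) ++ (match o with
    | none => [0]
    | some a => 1 :: a)

theorem setInfo_nodeInput {m : ℕ} (G : SimpleGraph (Fin m)) (x y : State m) (v : Fin m) :
    setInfo (nodeInput G x v) (y v) = nodeInput G y v := by
  cases h : y v <;> simp [setInfo, nodeInput, h]

/-- The words that follow the neighbours and the marker in `nodeInput G x v`. -/
def getInfo (l : List ℕ) : List ℕ := l.drop (l.headD 0 + 2)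

theorem getInfo_nodeInput {m : ℕ} {G : SimpleGraph (Fin m)} {x : State m} {v : Fin m}
    {a : List ℕ} (h : x v = some a) : getInfo (nodeInput G x v) = a := by
  simp only [getInfo, nodeInput, h, List.cons_append, List.headD_cons]
  rw [List.drop_succ_cons, List.drop_append]
  simp

/-- The neighbours listed in `nodeInput G x v`. -/
def getNeighbors (l : List ℕ) : List ℕ := l.tail.take (l.headD 0)

theorem mem_getNeighbors {m : ℕ} (G : SimpleGraph (Fin m)) (x : State m) (v u : Fin m) :
    (u : ℕ) ∈ getNeighbors (nodeInput G x v) ↔ G.Adj v u := by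
  simp [getNeighbors, nodeInput, Fin.val_inj]

theorem mem_getNeighbors_iff {m : ℕ} (G : SimpleGraph (Fin m)) (x : State m) (v : Fin m) (w : ℕ) :
    w ∈ getNeighbors (nodeInput G x v) ↔ ∃ h : w < m, G.Adj v ⟨w, h⟩ := by
  constructor
  · intro h
    have h1 : w < m := by
      simp only [getNeighbors, nodeInput, List.cons_append, List.headD_cons, List.tail_cons,
        List.take_left', List.mem_map] at h
      obtain ⟨u, -, rfl⟩ := h
      exact u.2
    exact ⟨h1, (mem_getNeighbors G x v ⟨w, h1⟩).1 h⟩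
  · rintro ⟨h, hadj⟩
    exact (mem_getNeighbors G x v ⟨w, h⟩).2 hadj

theorem adj_iff_of_nodeInput_eq {m : ℕ} {G G' : SimpleGraph (Fin m)} {x x' : State m} {v : Fin m}
    (h : nodeInput G x v = nodeInput G' x' v) (u : Fin m) : G.Adj v u ↔ G'.Adj v u := by
  rw [← mem_getNeighbors G x, h, mem_getNeighbors]

theorem info_eq_of_nodeInput_eq {m : ℕ} {G G' : SimpleGraph (Fin m)} {x x' : State m} {v : Fin m}
    (h : nodeInput G x v = nodeInput G' x' v) : x v = x' v := by
  simp only [nodeInput, List.cons_append, List.cons.injEq] at h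
  have h2 := (List.append_inj h.2 h.1).2
  cases h3 : x v <;> cases h4 : x' v <;> simp_all

theorem bdd_nodeInput {m d s W : ℕ} {G : SimpleGraph (Fin m)} {x : State m} {v : Fin m}
    {a : List ℕ} (hd : (G.neighborSet v).ncard ≤ d) (hx : x v = some a) (ha : Bdd s W a)
    (hdW : d < W) (hmW : m ≤ W) (hW : 1 < W) : Bdd (2 + d + s) W (nodeInput G x v) := by
  classical
  have h := length_neighbors_le G v hd
  constructor
  · simp only [nodeInput, hx, List.cons_append, List.length_cons, List.length_append,
      List.length_map]
    have := ha.1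
    convert_to _ + (_ + 1) + 1 ≤ _ using 2
    have h' : ∀ a b c d s : ℕ, a ≤ d → b ≤ s → a + (b + 1) + 1 ≤ 2 + d + s := by omega
    refine h' _ _ 0 _ _ ?_ this
    convert h
  · intro w hw
    simp only [nodeInput, hx, List.cons_append, List.mem_cons, List.mem_append,
      List.mem_map, List.length_map] at hw
    obtain rfl | ⟨u, -, rfl⟩ | rfl | hw := hw
    · refine lt_of_le_of_lt ?_ hdW
      convert h
    · omega
    · omega
    · exact ha.2 w hw

/-! ### Neighbourhoods -/

theorem edist_le_add_one_iff {m : ℕ} (G : SimpleGraph (Fin m)) (v u : Fin m) (j : ℕ) :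
    G.edist v u ≤ (j + 1 : ℕ) ↔ G.edist v u ≤ j ∨ ∃ w, G.Adj v w ∧ G.edist w u ≤ j := by
  constructor
  · intro h
    have hr : G.edist v u ≠ ⊤ := ne_top_of_le_ne_top (ENat.natCast_ne_top _) h
    obtain ⟨p, hp⟩ := SimpleGraph.exists_walk_of_edist_ne_top hr
    rw [← hp] at h
    cases p with
    | nil => left; simp
    | cons hadj p =>
      right
      refine ⟨_, hadj, p.edist_le.trans ?_⟩
      simp only [SimpleGraph.Walk.length_cons] at h
      exact_mod_cast Nat.le_of_succ_le_succ (by exact_mod_cast h)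
  · rintro (h | ⟨w, hw, h⟩)
    · exact h.trans (by exact_mod_cast Nat.le_succ j)
    · refine (SimpleGraph.edist_triangle (v := w)).trans ?_
      rw [SimpleGraph.edist_eq_one_iff_adj.2 hw, add_comm]
      push_cast
      gcongr

theorem ncard_ball_le {m : ℕ} (G : SimpleGraph (Fin m)) {d : ℕ}
    (hd : ∀ v, (G.neighborSet v).ncard ≤ d) (j : ℕ) (v : Fin m) :
    {u | G.edist v u ≤ j}.ncard ≤ (d + 1) ^ j := by
  classical
  induction j generalizing v with
  | zero => simp
  | succ j ih =>
    have hsub : {u | G.edist v u ≤ (j + 1 : ℕ)} ⊆ {u | G.edist v u ≤ j} ∪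
        ⋃ w ∈ (G.neighborSet v).toFinite.toFinset, {u | G.edist w u ≤ j} := by
      intro u hu
      rw [Set.mem_ofPred_eq, edist_le_add_one_iff] at hu
      simpa using hu
    refine (Set.ncard_le_ncard hsub (Set.toFinite _)).trans ((Set.ncard_union_le _ _).trans ?_)
    have h1 : (⋃ w ∈ (G.neighborSet v).toFinite.toFinset, {u | G.edist w u ≤ j}).ncard ≤
        d * (d + 1) ^ j := by
      refine (Finset.set_ncard_biUnion_le _ _).trans ?_
      refine (Finset.sum_le_card_nsmul _ _ ((d + 1) ^ j) fun w _ => ih w).trans ?_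
      rw [smul_eq_mul, ← Set.ncard_eq_toFinset_card]
      exact Nat.mul_le_mul_right _ (hd v)
    have h2 := ih v
    calc _ ≤ (d + 1) ^ j + d * (d + 1) ^ j := by gcongr
      _ = (d + 1) ^ (j + 1) := by ring

/-- The data of some of the nodes. -/
abbrev View (m : ℕ) := Fin m → Option (List ℕ)

open Classical in
/-- The `R`-hop neighbourhood of `v`: the data of the nodes at distance at most `R`. -/
noncomputable def view {m : ℕ} (R : ℕ) (G : SimpleGraph (Fin m)) (x : State m) (v : Fin m) :
    View m :=
  fun u => if G.edist v u ≤ R then some (nodeInput G x u) else none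

theorem view_eq_some_iff {m R : ℕ} {G : SimpleGraph (Fin m)} {x : State m} {v u : Fin m}
    {a : List ℕ} : view R G x v u = some a ↔ G.edist v u ≤ R ∧ nodeInput G x u = a := by
  unfold view
  split_ifs with h <;> simp [h]

theorem agreeNear_of_view_eq {m R : ℕ} {G G' : SimpleGraph (Fin m)} {x x' : State m} {v : Fin m}
    (h : view R G x v = view R G' x' v) : AgreeNear R G G' x x' v := by
  have h1 : ∀ u, G.edist v u ≤ R → G'.edist v u ≤ R ∧ nodeInput G' x' u = nodeInput G x u := by
    intro u hu
    rw [← view_eq_some_iff, ← h, view_eq_some_iff]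
    exact ⟨hu, rfl⟩
  refine ⟨fun u => ⟨fun hu => (h1 u hu).1, fun hu => ?_⟩, fun u w hu _ => ?_, fun u hu => ?_⟩
  · have : view R G x v u = some (nodeInput G' x' u) := by
      rw [h, view_eq_some_iff]; exact ⟨hu, rfl⟩
    exact (view_eq_some_iff.1 this).1
  · exact adj_iff_of_nodeInput_eq (h1 u hu).2.symm w
  · exact info_eq_of_nodeInput_eq (h1 u hu).2.symm

theorem AgreeNear.symm {m r : ℕ} {α : Type} {G G' : SimpleGraph (Fin m)} {x x' : Fin m → α}
    {v : Fin m} (h : AgreeNear r G G' x x' v) : AgreeNear r G' G x' x v :=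
  ⟨fun u => (h.1 u).symm, fun u w hu hw => (h.2.1 u w ((h.1 u).2 hu) ((h.1 w).2 hw)).symm,
    fun u hu => (h.2.2 u ((h.1 u).2 hu)).symm⟩

theorem AgreeNear.edist_le {m R : ℕ} {α : Type} {G G' : SimpleGraph (Fin m)} {x x' : Fin m → α}
    {v : Fin m} (h : AgreeNear R G G' x x' v) {a b : ℕ} (hab : a + b ≤ R) {u w : Fin m}
    (hu : G.edist v u ≤ a) (hw : G.edist u w ≤ b) : G'.edist u w ≤ b := by
  induction b generalizing a u with
  | zero =>
    have : u = w := by simpa using hw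
    simp [this]
  | succ b ih =>
    have hR : ∀ {z : Fin m} {c : ℕ}, c ≤ R → G.edist v z ≤ c → G.edist v z ≤ R :=
      fun hc hz => hz.trans (by exact_mod_cast hc)
    rw [edist_le_add_one_iff] at hw ⊢
    obtain hw | ⟨z, hz, hw⟩ := hw
    · exact Or.inl (ih (by omega) hu hw)
    · have hvz : G.edist v z ≤ (a + 1 : ℕ) := by
        refine (SimpleGraph.edist_triangle (v := u)).trans ?_
        rw [SimpleGraph.edist_eq_one_iff_adj.2 hz]
        push_cast
        gcongr
      refine Or.inr ⟨z, ?_, ih (a := a + 1) (by omega) hvz hw⟩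
      exact (h.2.1 u z (hR (by omega) hu) (hR (by omega) hvz)).1 hz

/-- If the neighbourhoods of `v` coincide up to distance `a + b`, then so do the neighbourhoods
up to distance `b` of the nodes at distance at most `a` from `v`. -/
theorem AgreeNear.near {m R : ℕ} {α β : Type} {G G' : SimpleGraph (Fin m)} {x x' : Fin m → α}
    {y y' : Fin m → β} {v : Fin m} (h : AgreeNear R G G' x x' v) {a b : ℕ} (hab : a + b ≤ R)
    {u : Fin m} (hu : G.edist v u ≤ a)
    (hy : ∀ w, G.edist v w ≤ R → y w = y' w) : AgreeNear b G G' y y' u := by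
  have hu' : G'.edist v u ≤ a :=
    h.edist_le (a := 0) (b := a) (by omega) (by simp) hu
  have hR : ∀ {w : Fin m}, G.edist u w ≤ b → G.edist v w ≤ R := fun hw =>
    (SimpleGraph.edist_triangle (v := u)).trans
      ((add_le_add hu hw).trans (by exact_mod_cast hab))
  exact ⟨fun w => ⟨h.edist_le hab hu, h.symm.edist_le hab hu'⟩,
    fun w z hw hz => h.2.1 w z (hR hw) (hR hz), fun w hw => hy w (hR hw)⟩

open Classical in
/-- The result of the local function `f` at a node, computed from the view of the node. -/
noncomputable def ofView {m : ℕ} {β : Type} [Inhabited β] (R : ℕ)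
    (f : SimpleGraph (Fin m) → State m → Fin m → β) (v : Fin m) (V : View m) : β :=
  if h : ∃ g : SimpleGraph (Fin m) × State m, view R g.1 g.2 v = V then
    f h.choose.1 h.choose.2 v else default

theorem ofView_view {m R : ℕ} {β : Type} [Inhabited β]
    {f : SimpleGraph (Fin m) → State m → Fin m → β} (hf : IsLocal R f) (G : SimpleGraph (Fin m))
    (x : State m) (v : Fin m) : ofView R f v (view R G x v) = f G x v := by
  have h : ∃ g : SimpleGraph (Fin m) × State m, view R g.1 g.2 v = view R G x v := ⟨(G, x), rfl⟩
  rw [ofView, dif_pos h]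
  exact hf _ _ _ _ _ (agreeNear_of_view_eq h.choose_spec)

/-! ### Encoding of views -/

/-- The entries of a view. -/
def viewList {m : ℕ} (V : View m) : List (List ℕ) :=
  (List.finRange m).filterMap fun u => (V u).map fun a => u.val :: a

theorem mem_viewList {m : ℕ} {V : View m} {l : List ℕ} :
    l ∈ viewList V ↔ ∃ u a, V u = some a ∧ (u : ℕ) :: a = l := by
  simp [viewList]

theorem viewList_injective {m : ℕ} : Function.Injective (viewList (m := m)) := by
  have key : ∀ (V V' : View m), viewList V = viewList V' → ∀ u a, V u = some a → V' u = some a := by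
    intro V V' h u a hu
    have : (u : ℕ) :: a ∈ viewList V' := h ▸ mem_viewList.2 ⟨u, a, hu, rfl⟩
    obtain ⟨u', a', h1, h2⟩ := mem_viewList.1 this
    simp only [List.cons.injEq, Fin.val_inj] at h2
    rwa [h2.1, h2.2] at h1
  intro V V' h
  funext u
  exact Option.ext fun a => ⟨key V V' h u a, key V' V h.symm u a⟩

theorem length_viewList_le {m : ℕ} (V : View m) :
    (viewList V).length ≤ {u | V u ≠ none}.ncard := by
  classical
  rw [viewList, List.length_filterMap_eq_countP, List.countP_eq_length_filter]
  have hn : ((List.finRange m).filter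
      fun u => ((V u).map fun a => u.val :: a).isSome).Nodup := (List.nodup_finRange m).filter _
  rw [← List.toFinset_card_of_nodup hn, ← Set.ncard_coe_finset]
  apply le_of_eq
  congr 1
  ext u
  simp [Option.isSome_iff_ne_none]

/-- A view as a list of words. -/
def encView {m : ℕ} (V : View m) : List ℕ := encLists (viewList V)

theorem encView_injective {m : ℕ} : Function.Injective (encView (m := m)) :=
  encLists_injective.comp viewList_injective

theorem encView_empty {m : ℕ} : encView (fun _ : Fin m => none) = [] := by
  simp [encView, viewList, encLists]

/-- Every node has at most `d` neighbours and information of at most `s` words less than `W`, and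
no node is deferred. -/
def Tame {m : ℕ} (d s W : ℕ) (G : SimpleGraph (Fin m)) (x : State m) : Prop :=
  (∀ v, (G.neighborSet v).ncard ≤ d) ∧ ∀ v, ∃ a, x v = some a ∧ Bdd s W a

theorem Tame.mono {m d s W W' : ℕ} {G : SimpleGraph (Fin m)} {x : State m} (h : Tame d s W G x)
    (hW : W ≤ W') : Tame d s W' G x :=
  ⟨h.1, fun v => let ⟨a, h1, h2⟩ := h.2 v; ⟨a, h1, h2.mono le_rfl hW⟩⟩

theorem Tame.bdd_nodeInput {m d s W : ℕ} {G : SimpleGraph (Fin m)} {x : State m}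
    (h : Tame d s W G x) (hdW : d < W) (hmW : m ≤ W) (hW : 1 < W) (v : Fin m) :
    Bdd (2 + d + s) W (nodeInput G x v) := by
  obtain ⟨a, h1, h2⟩ := h.2 v
  exact _root_.bdd_nodeInput (h.1 v) h1 h2 hdW hmW hW

theorem Tame.bdd_encView {m d s W R S : ℕ} {G : SimpleGraph (Fin m)} {x : State m}
    (h : Tame d s W G x) (hdW : d < W) (hmW : m ≤ W) (hW : 1 < W)
    (hS : (d + 1) ^ R * (4 + d + s) ≤ S) (v : Fin m) :
    Bdd S (W + 1) (encView (view R G x v)) := by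
  refine bdd_encLists (s := 3 + d + s) ?_ (le_trans ?_ hS)
  · intro a ha
    obtain ⟨u, b, h1, rfl⟩ := mem_viewList.1 ha
    obtain ⟨-, rfl⟩ := view_eq_some_iff.1 h1
    have h2 := h.bdd_nodeInput hdW hmW hW u
    refine ⟨by have := h2.1; simp only [List.length_cons]; omega, fun w hw => ?_⟩
    obtain rfl | hw := List.mem_cons.1 hw
    · omega
    · exact h2.2 w hw
  · have h1 := length_viewList_le (view R G x v)
    have h2 := ncard_ball_le G h.1 R v
    have h3 : {u | view R G x v u ≠ none} = {u | G.edist v u ≤ R} := by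
      ext u
      simp [view]
    rw [h3] at h1
    have := h1.trans h2
    calc _ ≤ (d + 1) ^ R * (3 + d + s + 1) := by gcongr
      _ = _ := by ring

theorem Tame.bdd_place {m M d s W : ℕ} {G : SimpleGraph (Fin m)} {x : State m}
    (h : Tame d s W G x) (hdW : d < W) (hmW : m ≤ W) (hW : 1 < W) (i : Fin M) :
    Bdd (2 + d + s) W (place M (nodeInput G x) i) := by
  unfold place
  split_ifs with hi
  · exact h.bdd_nodeInput hdW hmW hW _
  · simp [Bdd]

/-! ### Collecting neighbourhoods -/

/-- What a machine knows while a step is simulated: a part of the graph, a number (the leading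
digits of a seed), and a vector. -/
abbrev Knowledge (m : ℕ) := View m × ℕ × List ℕ

/-- The words stored for the knowledge of a machine. -/
def encKnow {m : ℕ} (a : Knowledge m) : List ℕ := encLists ([a.2.1] :: a.2.2 :: viewList a.1)

theorem encKnow_injective {m : ℕ} : Function.Injective (encKnow (m := m)) := by
  rintro ⟨V, p, l⟩ ⟨V', p', l'⟩ h
  have := encLists_injective h
  simp only [List.cons.injEq, and_true] at this
  obtain ⟨rfl, rfl, h'⟩ := this
  rw [viewList_injective h']

theorem bdd_encKnow {m S g W s : ℕ} {V : View m} {p : ℕ} {l : List ℕ}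
    (hV : Bdd S (W + 1) (encView V)) (hp : p < W) (hl : Bdd g W l) (hs : S + g + 3 ≤ s) :
    Bdd s (W + 1) (encKnow (V, p, l)) := by
  have h1 : Bdd 1 W [p] := ⟨le_rfl, by simpa using hp⟩
  exact (h1.encLists_cons (hl.encLists_cons hV)).mono (by omega) le_rfl

/-- The views of the nodes, placed on the first `m` of `M` machines. -/
noncomputable def placeView {m : ℕ} (M R : ℕ) (G : SimpleGraph (Fin m)) (x : State m)
    (i : Fin M) : View m :=
  if h : (i : ℕ) < m then view R G x ⟨i, h⟩ else fun _ => none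

/-- The entry of the node of machine `i` in the view of this machine. -/
def ownData {m M : ℕ} (i : Fin M) (V : View m) : List ℕ :=
  if h : (i : ℕ) < m then (V ⟨i, h⟩).getD [] else []

theorem ownData_placeView {m M R : ℕ} (G : SimpleGraph (Fin m)) (x : State m) (i : Fin M) :
    ownData i (placeView M R G x i) = place M (nodeInput G x) i := by
  unfold ownData placeView place
  split_ifs with h
  · simp [view]
  · rfl

theorem Tame.bdd_placeView {m M d s W R S : ℕ} {G : SimpleGraph (Fin m)} {x : State m}
    (h : Tame d s W G x) (hdW : d < W) (hmW : m ≤ W) (hW : 1 < W)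
    (hS : (d + 1) ^ R * (4 + d + s) ≤ S) (i : Fin M) :
    Bdd S (W + 1) (encView (placeView M R G x i)) := by
  unfold placeView
  split_ifs with hi
  · exact h.bdd_encView hdW hmW hW hS _
  · rw [encView_empty]
    simp [Bdd]

theorem card_neighbor_machines_le {m M d : ℕ} (hM : m ≤ M) (G : SimpleGraph (Fin m)) (v : Fin m)
    (hd : (G.neighborSet v).ncard ≤ d) (p : Fin M → Prop) [DecidablePred p]
    (hp : ∀ j, p j → ∃ h : (j : ℕ) < m, G.Adj v ⟨j, h⟩) :
    (Finset.univ.filter p).card ≤ d := by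
  classical
  refine le_trans ?_ hd
  rw [Set.ncard_eq_toFinset_card']
  refine (Finset.card_le_card (t := (G.neighborSet v).toFinset.image (Fin.castLE hM)) ?_).trans
    Finset.card_image_le
  intro j hj
  obtain ⟨h, hadj⟩ := hp j (Finset.mem_filter.1 hj).2
  rw [Finset.mem_image]
  exact ⟨⟨j, h⟩, by simpa using hadj, rfl⟩

open Classical in
/-- The view `V` together with the entries of the views in the messages. -/
noncomputable def mergeViews {m M : ℕ} (V : View m) (msg : Fin M → List ℕ) : View m :=
  fun u => if h : ∃ a j, Function.invFun encView (msg j) u = some a then some h.choose else V u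

open Classical in
/-- The message to machine `j` in a round in which all nodes send their views to their
neighbours. -/
noncomputable def sendView {m M : ℕ} (i : Fin M) (V : View m) (j : Fin M) : List ℕ :=
  if (j : ℕ) ∈ getNeighbors (ownData i V) then encView V else []

theorem mem_neighbors_ownData_iff {m M R : ℕ} (G : SimpleGraph (Fin m)) (x : State m)
    (i j : Fin M) : (j : ℕ) ∈ getNeighbors (ownData i (placeView M R G x i)) ↔
      ∃ (hi : (i : ℕ) < m) (hj : (j : ℕ) < m), G.Adj ⟨i, hi⟩ ⟨j, hj⟩ := by
  rw [ownData_placeView, place]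
  split_ifs with hi
  · rw [mem_getNeighbors_iff]
    exact ⟨fun h => ⟨hi, h⟩, fun h => h.2⟩
  · simp [getNeighbors, hi]

theorem mergeViews_placeView {m M R : ℕ} (hM : m ≤ M) (G : SimpleGraph (Fin m)) (x : State m)
    (i : Fin M) : mergeViews (placeView M R G x i)
      (fun j => sendView j (placeView M R G x j) i) = placeView M (R + 1) G x i := by
  classical
  have hdec : ∀ j u a, Function.invFun encView (sendView j (placeView M R G x j) i) u = some a ↔
      ∃ (hi : (i : ℕ) < m) (hj : (j : ℕ) < m), G.Adj ⟨i, hi⟩ ⟨j, hj⟩ ∧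
        G.edist ⟨j, hj⟩ u ≤ R ∧ nodeInput G x u = a := by
    intro j u a
    have hl := Function.leftInverse_invFun (encView_injective (m := m))
    unfold sendView
    split_ifs with h
    · rw [hl]
      obtain ⟨hj, hi, hadj⟩ := (mem_neighbors_ownData_iff G x j i).1 h
      rw [placeView, dif_pos hj, view_eq_some_iff]
      exact ⟨fun h => ⟨hi, hj, hadj.symm, h⟩, fun ⟨_, _, _, h⟩ => h⟩
    · rw [← encView_empty (m := m), hl]
      constructor
      · intro h'; simp at h'
      · rintro ⟨hi, hj, hadj, -⟩
        exact absurd ((mem_neighbors_ownData_iff G x j i).2 ⟨hj, hi, hadj.symm⟩) h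
  funext u
  unfold mergeViews
  simp only [hdec]
  unfold placeView
  by_cases hi : (i : ℕ) < m
  · simp only [hi, dif_pos]
    split_ifs with h
    · obtain ⟨j, _, hj, hadj, hu, ha⟩ := h.choose_spec
      symm
      rw [view_eq_some_iff, edist_le_add_one_iff]
      exact ⟨Or.inr ⟨_, hadj, hu⟩, ha⟩
    · unfold view
      by_cases h' : G.edist ⟨i, hi⟩ u ≤ R
      · rw [if_pos h', if_pos ((edist_le_add_one_iff _ _ _ _).2 (Or.inl h'))]
      · rw [if_neg h', if_neg]
        rw [edist_le_add_one_iff]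
        rintro (h'' | ⟨w, hw, hu⟩)
        · exact h' h''
        · exact h ⟨_, Fin.castLE hM w, trivial, w.2, hw, hu, rfl⟩
  · simp [hi]

theorem exists_gather_superstep {m M : ℕ} (hM : m ≤ M) {d s W R S s' : ℕ} (hdW : d < W)
    (hmW : m ≤ W) (hW : 1 < W) (hS : (d + 1) ^ (R + 1) * (4 + d + s) ≤ S)
    (hs' : S + 3 + d * S ≤ s') :
    ∃ p : List (Round M), p.length = 2 ∧ ∀ (G : SimpleGraph (Fin m)) (x : State m),
      Tame d s W G x → Runs s' (W + 1) p (quiet fun i => encKnow (placeView M R G x i, 0, []))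
        (quiet fun i => encKnow (placeView M (R + 1) G x i, 0, [])) := by
  classical
  have hS' : (d + 1) ^ R * (4 + d + s) ≤ S :=
    le_trans (Nat.mul_le_mul_right _ (Nat.pow_le_pow_right (by omega) (by omega))) hS
  refine ⟨superstep encKnow encKnow (fun i (a : Knowledge m) j => sendView i a.1 j)
    (fun _ a msg => ((mergeViews a.1 msg, 0, []) : Knowledge m)), rfl, fun G x hx => ?_⟩
  have hb : ∀ i : Fin M, Bdd S (W + 1) (encView (placeView M R G x i)) :=
    fun i => hx.bdd_placeView hdW hmW hW hS' i
  have hlen : ∀ i j : Fin M, (sendView i (placeView M R G x i) j).length ≤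
      if ∃ (hi : (i : ℕ) < m) (hj : (j : ℕ) < m), G.Adj ⟨i, hi⟩ ⟨j, hj⟩ then S else 0 := by
    intro i j
    unfold sendView
    simp only [mem_neighbors_ownData_iff]
    split_ifs
    · exact (hb i).1
    · simp
  have hcard : ∀ (i : Fin M) (p : Fin M → Prop) [DecidablePred p],
      (∀ j, p j → ∃ (hi : (i : ℕ) < m) (hj : (j : ℕ) < m), G.Adj ⟨i, hi⟩ ⟨j, hj⟩) →
      (∑ j, if p j then S else 0) ≤ d * S := by
    intro i p _ hp
    rw [← Finset.sum_filter, Finset.sum_const, smul_eq_mul]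
    refine Nat.mul_le_mul_right _ ?_
    by_cases hi : (i : ℕ) < m
    · exact card_neighbor_machines_le hM G ⟨i, hi⟩ (hx.1 _) p fun j hj =>
        let ⟨_, h⟩ := hp j hj; h
    · rw [Finset.filter_false_of_mem]
      · simp
      · intro j _ hj
        exact hi (hp j hj).1
  refine runs_superstep (s₁ := S + 3) (s₂ := d * S) encKnow_injective hs' ?_ ?_ ?_ ?_ ?_ ?_
  · intro i
    rw [mergeViews_placeView hM]
  · exact fun i => bdd_encKnow (hb i) (by omega) (g := 0) (by simp [Bdd]) le_rfl
  · exact fun i => (Finset.sum_le_sum fun j _ => hlen i j).trans (hcard i _ fun j h => h)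
  · exact fun i => (Finset.sum_le_sum fun j _ => hlen j i).trans
      (hcard i _ fun j ⟨hj, hi, h⟩ => ⟨hi, hj, h.symm⟩)
  · intro i j w hw
    unfold sendView at hw
    split_ifs at hw
    · exact (hb i).2 w hw
    · simp at hw
  · exact fun i => bdd_encKnow (hx.bdd_placeView hdW hmW hW hS i) (by omega) (g := 0) (by simp [Bdd]) le_rfl

theorem exists_gather {m M : ℕ} (hM : m ≤ M) {d s W S s' : ℕ} (hdW : d < W)
    (hmW : m ≤ W) (hW : 1 < W) (R : ℕ) (hS : (d + 1) ^ R * (4 + d + s) ≤ S)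
    (hs' : S + 3 + d * S ≤ s') :
    ∃ p : List (Round M), p.length = 2 * (R + 1) ∧ ∀ (G : SimpleGraph (Fin m)) (x : State m),
      Tame d s W G x → Runs s' (W + 1) p (quiet (place M (nodeInput G x)))
        (quiet fun i => encKnow (placeView M R G x i, 0, [])) := by
  classical
  induction R with
  | zero =>
    obtain ⟨p, hp, hrun⟩ := exists_local_superstep (M := M) (enc := id) (encKnow (m := m))
      Function.injective_id
      (fun i l => (if h : (i : ℕ) < m then fun u => if u = ⟨i, h⟩ then some l else none else
        fun _ => none, 0, [])) s' (W + 1)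
    refine ⟨p, hp, fun G x hx => ?_⟩
    have he : ∀ i : Fin M, ((if h : (i : ℕ) < m then fun u => if u = ⟨i, h⟩ then
        some (place M (nodeInput G x) i) else none else fun _ => none : View m)) =
          placeView M 0 G x i := by
      intro i
      unfold placeView place
      split_ifs with h
      · funext u
        unfold view
        by_cases hu : u = ⟨i, h⟩
        · simp [hu]
        · simp [hu, Ne.symm hu]
      · rfl
    have := hrun (place M (nodeInput G x)) ?_ ?_
    · simpa only [he, id] using this
    · intro i
      refine (Tame.bdd_place hx hdW hmW hW i).mono ?_ (by omega)
      simp only [pow_zero, one_mul] at hS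
      omega
    · intro i
      rw [he]
      exact bdd_encKnow (hx.bdd_placeView hdW hmW hW hS i) (by omega) (g := 0) (by simp [Bdd])
        (by omega)
  | succ R ih =>
    obtain ⟨p, hp, h1⟩ := ih
      (le_trans (Nat.mul_le_mul_right _ (Nat.pow_le_pow_right (by omega) (by omega))) hS)
    obtain ⟨p', hp', h2⟩ := exists_gather_superstep hM hdW hmW hW hS hs'
    exact ⟨p ++ p', by rw [List.length_append, hp, hp']; ring,
      fun G x hx => (h1 G x hx).append (h2 G x hx)⟩

/-- The last superstep of the simulation of a step: the nodes replace their information by the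
result, which they know how to compute. -/
theorem exists_finish {m M d s W S s' R : ℕ} (hdW : d < W) (hmW : m ≤ W) (hW : 1 < W)
    (hS : (d + 1) ^ R * (4 + d + s) ≤ S) (hs' : S + 3 ≤ s')
    (F : Fin m → View m → ℕ → Option (List ℕ)) :
    ∃ p : List (Round M), p.length = 2 ∧
      ∀ (G : SimpleGraph (Fin m)) (x y : State m) (t : ℕ), t < W → Tame d s W G x →
        Tame d s W G y → (∀ v, F v (view R G x v) t = y v) →
        Runs s' (W + 1) p (quiet fun i => encKnow (placeView M R G x i, t, []))
          (quiet (place M (nodeInput G y))) := by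
  obtain ⟨p, hp, hrun⟩ := exists_local_superstep (M := M) (enc := encKnow (m := m)) (id : List ℕ → _)
      encKnow_injective
      (fun i a => if h : (i : ℕ) < m then setInfo (ownData i a.1) (F ⟨i, h⟩ a.1 a.2.1) else [])
      s' (W + 1)
  refine ⟨p, hp, fun G x y t ht hx hy hF => ?_⟩
  have he : ∀ i : Fin M, (if h : (i : ℕ) < m then setInfo (ownData i (placeView M R G x i))
      (F ⟨i, h⟩ (placeView M R G x i) t) else []) = place M (nodeInput G y) i := by
    intro i
    rw [ownData_placeView]
    unfold place placeView
    split_ifs with h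
    · rw [hF, setInfo_nodeInput]
    · rfl
  have := hrun (fun i => (placeView M R G x i, t, [])) ?_ ?_
  · simpa only [he, id] using this
  · exact fun i => bdd_encKnow (hx.bdd_placeView hdW hmW hW hS i) ht (g := 0) (by simp [Bdd]) hs'
  · intro i
    rw [he]
    refine (Tame.bdd_place hy hdW hmW hW i).mono ?_ (by omega)
    have : 1 * (4 + d + s) ≤ (d + 1) ^ R * (4 + d + s) :=
      Nat.mul_le_mul_right _ (Nat.one_le_pow _ _ (by omega))
    omega

/-- Simulation of a deterministic LOCAL round. -/
theorem exists_local_round {m M : ℕ} (hM : m ≤ M) {d s W S s' : ℕ} (hdW : d < W)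
    (hmW : m ≤ W) (hW : 1 < W) (hS : (d + 1) ^ 1 * (4 + d + s) ≤ S) (hs' : S + 3 + d * S ≤ s')
    (f : SimpleGraph (Fin m) → State m → Fin m → List ℕ) :
    ∃ p : List (Round M), p.length = 6 ∧ ∀ (G : SimpleGraph (Fin m)) (x y : State m),
      Tame d s W G x → Tame d s W G y → IsLocal 1 f →
      (y = fun v => (x v).map fun _ => f G x v) →
      Runs s' (W + 1) p (quiet (place M (nodeInput G x))) (quiet (place M (nodeInput G y))) := by
  obtain ⟨p, hp, h1⟩ := exists_gather hM hdW hmW hW 1 hS hs'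
  obtain ⟨p', hp', h2⟩ := exists_finish (M := M) (s' := s') hdW hmW hW hS (by omega)
    (fun v V _ => some (ofView 1 f v V))
  refine ⟨p ++ p', by rw [List.length_append, hp, hp'], fun G x y hx hy hf hxy => ?_⟩
  refine (h1 G x hx).append (h2 G x y 0 (by omega) hx hy fun v => ?_)
  obtain ⟨a, ha, -⟩ := hx.2 v
  rw [ofView_view hf, hxy]
  simp [ha]

/-! ### Sums over all machines

The machines form a tree: the parent of machine `i` is machine `i / g`. -/

theorem card_children_le {M g : ℕ} (hg : 0 < g) (i : Fin M) :
    (Finset.univ.filter fun j : Fin M => (j : ℕ) / g = i).card ≤ g := by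
  refine (Finset.card_le_card_of_injOn (t := Finset.range g) (fun j : Fin M => (j : ℕ) % g) ?_ ?_).trans
    (Finset.card_range g).le
  · intro j _
    simpa using Nat.mod_lt _ hg
  · intro j hj j' hj' h
    simp only [Finset.coe_filter, Finset.mem_univ, true_and, Set.mem_ofPred_eq] at hj hj'
    simp only at h
    rw [Fin.ext_iff, ← Nat.div_add_mod (j : ℕ) g, ← Nat.div_add_mod (j' : ℕ) g, hj, hj', h]

theorem sum_tree_step {M g k : ℕ} (a : Fin M → ℕ) (i : Fin M) :
    (∑ j : Fin M, if (i : ℕ) = j / g then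
      (∑ l : Fin M, if (l : ℕ) / g ^ k = j then a l else 0) else 0) =
    ∑ l : Fin M, if (l : ℕ) / g ^ (k + 1) = i then a l else 0 := by
  have h1 : ∀ j : Fin M, (if (i : ℕ) = j / g then
      (∑ l : Fin M, if (l : ℕ) / g ^ k = j then a l else 0) else 0) =
      ∑ l : Fin M, if (i : ℕ) = j / g ∧ (l : ℕ) / g ^ k = j then a l else 0 := by
    intro j
    split_ifs with h <;> simp [h]
  simp only [h1]
  rw [Finset.sum_comm]
  refine Finset.sum_congr rfl fun l _ => ?_
  have hl : (l : ℕ) / g ^ k < M := (Nat.div_le_self _ _).trans_lt l.2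
  rw [Finset.sum_eq_single ⟨(l : ℕ) / g ^ k, hl⟩]
  · simp only [and_true, pow_succ, ← Nat.div_div_eq_div_mul, eq_comm]
  · intro j _ hj
    rw [if_neg]
    rintro ⟨-, h⟩
    exact hj (Fin.ext h.symm)
  · simp

theorem getD_ofFn {g : ℕ} (f : Fin g → ℕ) (b : Fin g) : (List.ofFn f).getD b 0 = f b := by
  rw [List.getD_eq_getElem _ _ (by simp)]
  simp

theorem bdd_ofFn {g W : ℕ} {f : Fin g → ℕ} (h : ∀ b, f b < W) : Bdd g W (List.ofFn f) :=
  ⟨by simp, by simpa [List.mem_ofFn] using h⟩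

theorem sum_subset_lt {M W A : ℕ} (hA : M * A < W) (a : Fin M → ℕ) (ha : ∀ i, a i ≤ A)
    (p : Fin M → Prop) [DecidablePred p] : (∑ l, if p l then a l else 0) < W := by
  refine lt_of_le_of_lt ?_ hA
  refine (Finset.sum_le_card_nsmul _ _ A fun l _ => ?_).trans (by simp)
  split_ifs
  · exact ha l
  · omega

/-- After `k` supersteps machine `i` holds the sum of the vectors of its descendants of the `k`-th
generation. -/
theorem exists_tree_up {m M g S W A s' : ℕ} (hg : 0 < g) (hA : M * A < W)
    (hs' : S + g + 3 + g * g ≤ s') (k : ℕ) :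
    ∃ p : List (Round M), p.length = 2 * k ∧
      ∀ (V : Fin M → View m) (t : ℕ) (a : Fin M → Fin g → ℕ),
        (∀ i, Bdd S (W + 1) (encView (V i))) → t < W → (∀ i b, a i b ≤ A) → ∀ (_ : 0 < M),
        Runs s' (W + 1) p (quiet fun i => encKnow (V i, t, List.ofFn (a i)))
          (quiet fun i => encKnow (V i, t, List.ofFn fun b =>
            ∑ l : Fin M, if (l : ℕ) / g ^ k = i then a l b else 0)) := by
  induction k with
  | zero =>
    refine ⟨[], rfl, fun V t a hV ht ha hM => ?_⟩
    have he : ∀ (i : Fin M) (b : Fin g), (∑ l : Fin M, if (l : ℕ) / g ^ 0 = i then a l b else 0) = a i b := by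
      intro i b
      simp [Fin.val_inj]
    simp only [he]
    refine ⟨rfl, fun i => ?_⟩
    have h1 : Bdd g W (List.ofFn (a i)) := bdd_ofFn fun b =>
      (ha i b).trans_lt ((Nat.le_mul_of_pos_left A hM).trans_lt hA)
    have h2 := bdd_encKnow (hV i) ht h1 le_rfl
    refine ⟨?_, by simp [quiet], h2.2, by simp [quiet]⟩
    have := h2.1
    simp only [quiet, List.length_nil, Finset.sum_const_zero]
    omega
  | succ k ih =>
    obtain ⟨p, hp, hrun⟩ := ih
    refine ⟨p ++ superstep encKnow encKnow
      (fun i (a : Knowledge m) j => if (j : ℕ) = i / g then a.2.2 else [])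
      (fun _ a msg => ((a.1, a.2.1, List.ofFn fun b : Fin g => ∑ j, (msg j).getD b 0) :
        Knowledge m)), by rw [List.length_append, hp]; rfl, fun V t a hV ht ha hM => ?_⟩
    have hb : ∀ (k : ℕ) (i : Fin M), Bdd g W (List.ofFn fun b : Fin g =>
        ∑ l : Fin M, if (l : ℕ) / g ^ k = i then a l b else 0) := fun k i =>
      bdd_ofFn fun b => sum_subset_lt hA _ (fun l => ha l b) _
    refine (hrun V t a hV ht ha hM).append ?_
    refine runs_superstep (s₁ := S + g + 3) (s₂ := g * g) encKnow_injective hs' ?_ ?_ ?_ ?_ ?_ ?_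
    · intro i
      simp only [Prod.mk.injEq, true_and]
      congr 1
      funext b
      rw [← sum_tree_step]
      refine Finset.sum_congr rfl fun j _ => ?_
      split_ifs
      · exact getD_ofFn _ b
      · simp
    · exact fun i => bdd_encKnow (hV i) ht (hb k i) le_rfl
    · intro i
      have hi : (i : ℕ) / g < M := (Nat.div_le_self _ _).trans_lt i.2
      rw [Finset.sum_eq_single ⟨(i : ℕ) / g, hi⟩]
      · simp only [if_true, List.length_ofFn]
        exact Nat.le_mul_of_pos_left _ hg
      · intro j _ hj
        rw [if_neg fun h => hj (Fin.ext h)]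
        rfl
      · simp
    · intro i
      have : ∀ j : Fin M, (if (i : ℕ) = j / g then List.ofFn fun b : Fin g =>
          ∑ l : Fin M, if (l : ℕ) / g ^ k = j then a l b else 0 else []).length =
          if (j : ℕ) / g = i then g else 0 := by
        intro j
        by_cases h : (i : ℕ) = j / g
        · simp [h]
        · simp [h, Ne.symm h]
      simp only [this]
      rw [← Finset.sum_filter, Finset.sum_const, smul_eq_mul]
      exact Nat.mul_le_mul_right _ (card_children_le hg i)
    · intro i j w hw
      split_ifs at hw
      · exact ((hb k i).2 w hw).trans (by omega)
      · simp at hw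
    · exact fun i => bdd_encKnow (hV i) ht (hb (k + 1) i) le_rfl

/-- After `k` supersteps machine `i` holds the vector of its ancestor of the `k`-th generation. -/
theorem exists_tree_down {m M g S W s' : ℕ} (hg : 0 < g)
    (hs' : S + g + 3 + g * g ≤ s') (k : ℕ) :
    ∃ p : List (Round M), p.length = 2 * k ∧
      ∀ (V : Fin M → View m) (t : ℕ) (a : ℕ → Fin g → ℕ),
        (∀ i, Bdd S (W + 1) (encView (V i))) → t < W → (∀ i < M, ∀ b, a i b < W) →
        Runs s' (W + 1) p (quiet fun i => encKnow (V i, t, List.ofFn (a i)))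
          (quiet fun i => encKnow (V i, t, List.ofFn (a (i / g ^ k)))) := by
  induction k with
  | zero =>
    refine ⟨[], rfl, fun V t a hV ht ha => ?_⟩
    simp only [pow_zero, Nat.div_one]
    refine ⟨rfl, fun i => ?_⟩
    have h2 := bdd_encKnow (hV i) ht (bdd_ofFn (ha i i.2)) le_rfl
    refine ⟨?_, by simp [quiet], h2.2, by simp [quiet]⟩
    have := h2.1
    simp only [quiet, List.length_nil, Finset.sum_const_zero]
    omega
  | succ k ih =>
    obtain ⟨p, hp, hrun⟩ := ih
    refine ⟨p ++ superstep encKnow encKnow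
      (fun i (a : Knowledge m) j => if (i : ℕ) = j / g then a.2.2 else [])
      (fun i a msg => ((a.1, a.2.1, msg ⟨(i : ℕ) / g, (Nat.div_le_self _ _).trans_lt i.2⟩) :
        Knowledge m)), by rw [List.length_append, hp]; rfl, fun V t a hV ht ha => ?_⟩
    have hlt : ∀ (k : ℕ) (i : Fin M), (i : ℕ) / g ^ k < M := fun k i =>
      (Nat.div_le_self _ _).trans_lt i.2
    have hb : ∀ (k : ℕ) (i : Fin M), Bdd g W (List.ofFn (a (i / g ^ k))) :=
      fun k i => bdd_ofFn (ha _ (hlt k i))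
    refine (hrun V t a hV ht ha).append ?_
    refine runs_superstep (s₁ := S + g + 3) (s₂ := g * g) encKnow_injective hs' ?_ ?_ ?_ ?_ ?_ ?_
    · intro i
      simp only [if_true, Nat.div_div_eq_div_mul, pow_succ']
    · exact fun i => bdd_encKnow (hV i) ht (hb k i) le_rfl
    · intro i
      have : ∀ j : Fin M, (if (i : ℕ) = j / g then List.ofFn (a (i / g ^ k)) else []).length =
          if (j : ℕ) / g = i then g else 0 := by
        intro j
        by_cases h : (i : ℕ) = j / g
        · simp [h]
        · simp [h, Ne.symm h]
      simp only [this]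
      rw [← Finset.sum_filter, Finset.sum_const, smul_eq_mul]
      exact Nat.mul_le_mul_right _ (card_children_le hg i)
    · intro i
      have hi : (i : ℕ) / g < M := (Nat.div_le_self _ _).trans_lt i.2
      rw [Finset.sum_eq_single ⟨(i : ℕ) / g, hi⟩]
      · simp only [if_true, List.length_ofFn]
        exact Nat.le_mul_of_pos_left _ hg
      · intro j _ hj
        rw [if_neg fun h => hj (Fin.ext h)]
        rfl
      · simp
    · intro i j w hw
      split_ifs at hw
      · exact ((hb k i).2 w hw).trans (by omega)
      · simp at hw
    · exact fun i => bdd_encKnow (hV i) ht (hb (k + 1) i) le_rfl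

theorem exists_sum_all {m M g S W A s' D : ℕ} (hg : 0 < g) (hM : 0 < M) (hD : M ≤ g ^ D)
    (hA : M * A < W) (hs' : S + g + 3 + g * g ≤ s') :
    ∃ p : List (Round M), p.length = 4 * D ∧
      ∀ (V : Fin M → View m) (t : ℕ) (a : Fin M → Fin g → ℕ),
        (∀ i, Bdd S (W + 1) (encView (V i))) → t < W → (∀ i b, a i b ≤ A) →
        Runs s' (W + 1) p (quiet fun i => encKnow (V i, t, List.ofFn (a i)))
          (quiet fun i => encKnow (V i, t, List.ofFn fun b => ∑ l : Fin M, a l b)) := by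
  obtain ⟨p, hp, h1⟩ := exists_tree_up (m := m) (M := M) (S := S) hg hA hs' D
  obtain ⟨p', hp', h2⟩ := exists_tree_down (m := m) (M := M) (S := S) (W := W) hg hs' D
  refine ⟨p ++ p', by rw [List.length_append, hp, hp']; ring, fun V t a hV ht ha => ?_⟩
  refine (h1 V t a hV ht ha hM).append ?_
  have h3 := h2 V t (fun i b => ∑ l : Fin M, if (l : ℕ) / g ^ D = i then a l b else 0) hV ht
    fun i _ b => sum_subset_lt hA _ (fun l => ha l b) _
  have h0 : ∀ l : Fin M, (l : ℕ) / g ^ D = 0 := fun l => Nat.div_eq_of_lt (l.2.trans_le hD)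
  simpa only [h0, if_true] using h3

/-! ### A short list of random strings that serves all neighbourhoods -/

/-- If `6 m L < N`, then among `N` independent uniform samples with positive probability fewer than
`N / m` lie in any given one of at most `exp L` sets of density at most `1 / (2 m)`.  The
expectation of `2 ^ X`, for the number `X` of samples in one of the sets, is at most
`(1 + 1 / (2 m)) ^ N ≤ exp (N / (2 m))`, whereas `2 ^ X ≥ 2 ^ (N / m)` if `X ≥ N / m`; and
`log 2 - 1 / 2 > 1 / 6`. -/
theorem exists_samples {Ω ι : Type*} [Fintype Ω] [Nonempty Ω] [DecidableEq Ω] [Fintype ι]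
    (bad : ι → Finset Ω) {m N L : ℕ} (hm : 0 < m)
    (hbad : ∀ i, 2 * m * (bad i).card ≤ Fintype.card Ω)
    (hι : (Fintype.card ι : ℝ) ≤ Real.exp L) (hN : 6 * m * L < N) :
    ∃ ρ : Fin N → Ω, ∀ i, m * (Finset.univ.filter fun t => ρ t ∈ bad i).card < N := by
  by_contra! hcon
  have hm' : (0 : ℝ) < m := by exact_mod_cast hm
  have hΩ : (0 : ℝ) < Fintype.card Ω := by exact_mod_cast Fintype.card_pos
  -- Every sequence of samples is counted for at least one of the sets.
  have h1 : ∀ ρ : Fin N → Ω, (2 : ℝ) ^ ((N : ℝ) / m) ≤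
      ∑ i, ∏ t, (if ρ t ∈ bad i then (2 : ℝ) else 1) := by
    intro ρ
    obtain ⟨i, hi⟩ := hcon ρ
    have hnn : ∀ i ∈ Finset.univ, (0 : ℝ) ≤ ∏ t, (if ρ t ∈ bad i then (2 : ℝ) else 1) :=
      fun i _ => Finset.prod_nonneg fun t _ => by split_ifs <;> norm_num
    refine le_trans ?_ (Finset.single_le_sum hnn (Finset.mem_univ i))
    rw [Finset.prod_ite, Finset.prod_const, Finset.prod_const_one, mul_one, ← Real.rpow_natCast]
    refine Real.rpow_le_rpow_of_exponent_le (by norm_num) ?_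
    rw [div_le_iff₀ hm', mul_comm]
    exact_mod_cast hi
  have h2 : ∀ i, ∑ ρ : Fin N → Ω, ∏ t, (if ρ t ∈ bad i then (2 : ℝ) else 1) ≤
      (Fintype.card Ω : ℝ) ^ N * Real.exp (N / (2 * m)) := by
    intro i
    rw [← Fintype.sum_pow (fun ω => if ω ∈ bad i then (2 : ℝ) else 1) N]
    have h3 : ∑ ω, (if ω ∈ bad i then (2 : ℝ) else 1) = Fintype.card Ω + (bad i).card := by
      have : ∀ ω, (if ω ∈ bad i then (2 : ℝ) else 1) = 1 + if ω ∈ bad i then (1 : ℝ) else 0 := by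
        intro ω; split_ifs <;> norm_num
      simp [this, Finset.sum_add_distrib]
    have h4 : (Fintype.card Ω : ℝ) + (bad i).card ≤
        Fintype.card Ω * Real.exp (1 / (2 * m)) := by
      have h5 : ((bad i).card : ℝ) ≤ Fintype.card Ω * (1 / (2 * m)) := by
        rw [mul_one_div, le_div_iff₀ (by positivity)]
        have := hbad i
        have h6 : (2 * m * (bad i).card : ℝ) ≤ Fintype.card Ω := by exact_mod_cast this
        linarith
      have h6 := Real.add_one_le_exp (1 / (2 * m : ℝ))
      nlinarith
    rw [h3]
    calc ((Fintype.card Ω : ℝ) + (bad i).card) ^ N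
        ≤ (Fintype.card Ω * Real.exp (1 / (2 * m))) ^ N := by gcongr
      _ = (Fintype.card Ω : ℝ) ^ N * Real.exp (N / (2 * m)) := by
        rw [mul_pow, ← Real.exp_nat_mul, mul_one_div]
  have h3 : (Fintype.card Ω : ℝ) ^ N * (2 : ℝ) ^ ((N : ℝ) / m) ≤
      (Fintype.card Ω : ℝ) ^ N * (Real.exp L * Real.exp (N / (2 * m))) := by
    calc (Fintype.card Ω : ℝ) ^ N * (2 : ℝ) ^ ((N : ℝ) / m)
        = ∑ _ρ : Fin N → Ω, (2 : ℝ) ^ ((N : ℝ) / m) := by simp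
      _ ≤ ∑ ρ : Fin N → Ω, ∑ i, ∏ t, (if ρ t ∈ bad i then (2 : ℝ) else 1) :=
        Finset.sum_le_sum fun ρ _ => h1 ρ
      _ = ∑ i, ∑ ρ : Fin N → Ω, ∏ t, (if ρ t ∈ bad i then (2 : ℝ) else 1) := Finset.sum_comm
      _ ≤ ∑ _i : ι, (Fintype.card Ω : ℝ) ^ N * Real.exp (N / (2 * m)) :=
        Finset.sum_le_sum fun i _ => h2 i
      _ = Fintype.card ι * ((Fintype.card Ω : ℝ) ^ N * Real.exp (N / (2 * m))) := by simp
      _ ≤ Real.exp L * ((Fintype.card Ω : ℝ) ^ N * Real.exp (N / (2 * m))) := by gcongr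
      _ = _ := by ring
  have h4 := le_of_mul_le_mul_left h3 (by positivity)
  rw [← Real.exp_add, Real.rpow_def_of_pos (by norm_num), Real.exp_le_exp] at h4
  have h5 : (N : ℝ) / (2 * m) = N / m / 2 := by field_simp
  have h6 : 6 * (L : ℝ) < N / m := by
    rw [lt_div_iff₀ hm']
    have : (6 * m * L : ℝ) < N := by exact_mod_cast hN
    linarith
  have h7 := Real.log_two_gt_d9
  have h8 : (0 : ℝ) ≤ L := by positivity
  rw [h5] at h4
  nlinarith

/-- A list of at most `S` words less than `W` as an element of a finite type. -/
def listKey (S W : ℕ) (l : List ℕ) : Fin S → Fin (W + 1) :=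
  fun i => Fin.ofNat (W + 1) ((l.map Nat.succ).getD i 0)

theorem eq_of_getD_map_succ_eq {l l' : List ℕ}
    (h : ∀ i, (l.map Nat.succ).getD i 0 = (l'.map Nat.succ).getD i 0) : l = l' := by
  apply List.ext_getElem?
  intro i
  have := h i
  simp only [List.getD_eq_getElem?_getD, List.getElem?_map] at this
  cases h1 : l[i]? <;> cases h2 : l'[i]? <;> simp_all

theorem listKey_inj {S W : ℕ} {l l' : List ℕ} (hl : Bdd S W l) (hl' : Bdd S W l')
    (h : listKey S W l = listKey S W l') : l = l' := by
  have hlt : ∀ (l : List ℕ), Bdd S W l → ∀ i, (l.map Nat.succ).getD i 0 < W + 1 := by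
    intro l hl i
    by_cases hi : i < l.length
    · rw [List.getD_eq_getElem _ _ (by simpa using hi)]
      have := hl.2 _ (List.getElem_mem hi)
      simpa using this
    · rw [List.getD_eq_default _ _ (by simpa using hi)]
      omega
  apply eq_of_getD_map_succ_eq
  intro i
  by_cases hi : i < S
  · have := congrArg Fin.val (congrFun h ⟨i, hi⟩)
    simp only [listKey, Fin.val_ofNat, Nat.mod_eq_of_lt (hlt l hl i),
      Nat.mod_eq_of_lt (hlt l' hl' i)] at this
    exact this
  · have := hl.1
    have := hl'.1
    rw [List.getD_eq_default _ _ (by simp; omega), List.getD_eq_default _ _ (by simp; omega)]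

theorem card_keys_le (m S W : ℕ) :
    (Fintype.card (Fin m × (Fin S → Fin (W + 1))) : ℝ) ≤ Real.exp ((m + W * S : ℕ) : ℝ) := by
  have h1 := Real.add_one_le_exp (m : ℝ)
  have h2 := Real.add_one_le_exp (W : ℝ)
  simp only [Fintype.card_prod, Fintype.card_fin, Fintype.card_pi, Finset.prod_const,
    Finset.card_univ]
  push_cast
  rw [Real.exp_add, mul_comm (W : ℝ) S, Real.exp_nat_mul]
  gcongr
  linarith

/-! ### Procedures -/

/-- The outcome of a procedure at a node depends on the neighbourhood of the node only. -/
theorem RandProc.isLocal_run {m τ : ℕ} {p : RandProc m} (h : IsLocal τ p.out) :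
    IsLocal τ fun G x v ρ => p.run G x ρ v := by
  intro G G' x x' v hv
  funext ρ
  have h1 := h G G' (fun u => (x u, ρ u)) (fun u => (x' u, ρ u)) v
    ⟨hv.1, hv.2.1, fun u hu => by simp only [hv.2.2 u hu]⟩
  have h2 := hv.2.2 v (by simp)
  simp only [RandProc.run, h1, h2]

/-- The strong success property of the outcome is determined by the neighbourhood of twice the
radius. -/
theorem RandProc.isLocal_ssp_run {m τ : ℕ} {p : RandProc m} (h : IsLocal τ p.out)
    (h' : IsLocal τ p.ssp) : IsLocal (2 * τ) fun G x v ρ => p.ssp G (p.run G x ρ) v := by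
  intro G G' x x' v hv
  funext ρ
  refine h' _ _ _ _ _ ⟨fun u => ?_, fun u w hu hw => hv.2.1 u w ?_ ?_, fun u hu => ?_⟩
  · exact (hv.near (a := 0) (b := τ) (by omega) (by simp) hv.2.2).1 u
  · exact hu.trans (by exact_mod_cast (by omega : τ ≤ 2 * τ))
  · exact hw.trans (by exact_mod_cast (by omega : τ ≤ 2 * τ))
  · exact congrFun (RandProc.isLocal_run h G G' x x' u
      (hv.near (a := τ) (b := τ) (by omega) hu hv.2.2)) ρ

theorem IsLocal.mono {m r r' : ℕ} {α β : Type}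
    {f : SimpleGraph (Fin m) → (Fin m → α) → Fin m → β} (h : IsLocal r f) (hr : r ≤ r') :
    IsLocal r' f := fun G G' x x' v hv =>
  h G G' x x' v (hv.near (a := 0) (b := r) (by omega) (by simp) hv.2.2)

open Classical in
theorem RandProc.IsNormal.card_bad_le {m : ℕ} {p : RandProc m} {q : Params}
    {G : SimpleGraph (Fin m)} {x : State m} (h : p.IsNormal q G x) {v : Fin m}
    (hv : x v ≠ none) :
    2 * m * (Finset.univ.filter fun ρ => ¬ p.ssp G (p.run G x ρ) v).card ≤
      Fintype.card (Fin m → Fin p.bits → Bool) := by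
  have h1 := h.success v hv
  have hm : (0 : ℝ) < m := by exact_mod_cast v.pos
  have hΩ : (0 : ℝ) < Fintype.card (Fin m → Fin p.bits → Bool) := by
    exact_mod_cast Fintype.card_pos
  rw [Nat.card_eq_fintype_card, Nat.card_eq_fintype_card, Fintype.card_subtype,
    le_div_iff₀ hΩ] at h1
  have h2 := Finset.card_filter_add_card_filter_not (s := Finset.univ)
    (fun ρ : Fin m → Fin p.bits → Bool => p.ssp G (p.run G x ρ) v)
  rw [Finset.card_univ] at h2
  have h3 : ((Finset.univ.filter fun ρ => p.ssp G (p.run G x ρ) v).card : ℝ) +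
    (Finset.univ.filter fun ρ => ¬ p.ssp G (p.run G x ρ) v).card =
      Fintype.card (Fin m → Fin p.bits → Bool) := by exact_mod_cast h2
  have h4 : ((Finset.univ.filter fun ρ => ¬ p.ssp G (p.run G x ρ) v).card : ℝ) ≤
      Fintype.card (Fin m → Fin p.bits → Bool) / (2 * m) := by
    have : (1 - 1 / (2 * (m : ℝ))) * Fintype.card (Fin m → Fin p.bits → Bool) =
      Fintype.card (Fin m → Fin p.bits → Bool) -
        Fintype.card (Fin m → Fin p.bits → Bool) / (2 * m) := by ring
    linarith
  rw [le_div_iff₀ (by positivity)] at h4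
  have h5 : (2 * m * (Finset.univ.filter fun ρ => ¬ p.ssp G (p.run G x ρ) v).card : ℝ) ≤
      Fintype.card (Fin m → Fin p.bits → Bool) := by linarith
  exact_mod_cast h5

open Classical in
/-- A list of `N` strings of random bits, which does not depend on the graph, such that every node
of every graph violates the strong success property for less than a fraction `1 / m` of them. -/
theorem exists_seeds {m : ℕ} (p : RandProc m) (q : Params) {d s W S N : ℕ} (hdW : d < W)
    (hmW : m ≤ W) (hW : 1 < W) (hm : 0 < m) (hS : (d + 1) ^ (2 * q.τ) * (4 + d + s) ≤ S)
    (hN : 6 * m * (m + (W + 1) * S) < N) :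
    ∃ ρ : ℕ → Fin m → Fin p.bits → Bool, ∀ (G : SimpleGraph (Fin m)) (x : State m),
      Tame d s W G x → p.IsNormal q G x → ∀ v,
      m * ((Finset.range N).filter fun t => ¬ p.ssp G (p.run G x (ρ t)) v).card < N := by
  let good (i : Fin m × (Fin S → Fin (W + 1 + 1))) (g : SimpleGraph (Fin m) × State m) : Prop :=
    Tame d s W g.1 g.2 ∧ p.IsNormal q g.1 g.2 ∧
      listKey S (W + 1) (encView (view (2 * q.τ) g.1 g.2 i.1)) = i.2
  let bad (i : Fin m × (Fin S → Fin (W + 1 + 1))) : Finset (Fin m → Fin p.bits → Bool) :=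
    if h : ∃ g, good i g then
      Finset.univ.filter fun ρ => ¬ p.ssp h.choose.1 (p.run h.choose.1 h.choose.2 ρ) i.1
    else ∅
  obtain ⟨ρ, hρ⟩ := exists_samples bad hm (L := m + (W + 1) * S) (N := N) (by
    intro i
    simp only [bad]
    split_ifs with h
    · obtain ⟨h1, h2, -⟩ := h.choose_spec
      obtain ⟨a, ha, -⟩ := h1.2 i.1
      exact h2.card_bad_le (by simp [ha])
    · simp) (card_keys_le m S (W + 1)) hN
  refine ⟨fun t => if h : t < N then ρ ⟨t, h⟩ else fun _ _ => false, fun G x hx hp v => ?_⟩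
  let i : Fin m × (Fin S → Fin (W + 1 + 1)) :=
    (v, listKey S (W + 1) (encView (view (2 * q.τ) G x v)))
  have hi : ∃ g, good i g := ⟨(G, x), hx, hp, rfl⟩
  refine lt_of_le_of_lt (Nat.mul_le_mul_left _ ?_) (hρ i)
  have hsub : ((Finset.range N).filter fun t => ¬ p.ssp G (p.run G x
      (if h : t < N then ρ ⟨t, h⟩ else fun _ _ => false)) v) ⊆
      (Finset.univ.filter fun t => ρ t ∈ bad i).image Fin.val := by
    intro t ht
    rw [Finset.mem_filter, Finset.mem_range] at ht
    obtain ⟨ht, h⟩ := ht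
    rw [dif_pos ht] at h
    rw [Finset.mem_image]
    refine ⟨⟨t, ht⟩, ?_, rfl⟩
    simp only [Finset.mem_filter, Finset.mem_univ, true_and, bad, dif_pos hi]
    obtain ⟨h1, h2, h3⟩ := hi.choose_spec
    have h4 := listKey_inj (h1.bdd_encView hdW hmW hW hS v) (hx.bdd_encView hdW hmW hW hS v) h3
    have h5 := p.isLocal_ssp_run hp.out_local hp.ssp_local _ _ _ _ v
      (agreeNear_of_view_eq (encView_injective h4))
    exact fun hc => h ((congrFun h5 (ρ ⟨t, ht⟩)).mp hc)
  exact (Finset.card_le_card hsub).trans Finset.card_image_le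

/-! ### The search for a good seed -/

open Classical in
/-- The number of seeds `t < N` with `t / g ^ l = p` that are bad for machine `i` with view `V`;
only the machines of nodes count. -/
noncomputable def badCount {m M : ℕ} (bad : Fin m → View m → ℕ → Prop) (g N l p : ℕ) (i : Fin M)
    (V : View m) : ℕ :=
  if h : (i : ℕ) < m then
    ((Finset.range N).filter fun t => t / g ^ l = p ∧ bad ⟨i, h⟩ V t).card else 0

theorem badCount_le {m M : ℕ} (bad : Fin m → View m → ℕ → Prop) (g N l p : ℕ) (i : Fin M)
    (V : View m) : badCount bad g N l p i V ≤ N := by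
  classical
  unfold badCount
  split_ifs
  · refine le_trans (Finset.card_filter_le _ _) (by simp)
  · exact Nat.zero_le _

theorem sum_badCount {m M : ℕ} (bad : Fin m → View m → ℕ → Prop) {g : ℕ} (N l p : ℕ) (hg : 0 < g)
    (i : Fin M) (V : View m) :
    ∑ b : Fin g, badCount bad g N l (p * g + b) i V = badCount bad g N (l + 1) p i V := by
  classical
  unfold badCount
  split_ifs with h
  · simp only [Finset.card_filter]
    rw [Finset.sum_comm]
    refine Finset.sum_congr rfl fun t _ => ?_
    rw [pow_succ, ← Nat.div_div_eq_div_mul]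
    have hdm := Nat.div_add_mod (t / g ^ l) g
    rw [Finset.sum_eq_single ⟨t / g ^ l % g, Nat.mod_lt _ hg⟩]
    · refine if_congr (and_congr_left' ?_) rfl rfl
      constructor
      · intro h1
        rw [h1, mul_comm, Nat.mul_add_div hg, Nat.div_eq_of_lt (Nat.mod_lt _ hg), add_zero]
      · rintro rfl
        rw [mul_comm]
        exact hdm.symm
    · intro b _ hb
      rw [if_neg]
      rintro ⟨h1, -⟩
      apply hb
      ext
      simp [h1, Nat.mod_eq_of_lt b.2]
    · simp
  · simp

/-- One digit of the seed is fixed: if few of the seeds with the leading digits `p` are bad, then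
the same holds with a suitable digit appended. -/
theorem exists_next_digit {m M g h S W s' D : ℕ} (hg : 0 < g) (hM : 0 < M) (hD : M ≤ g ^ D)
    (hA : M * g ^ h < W) (hs' : S + g + 3 + g * g ≤ s') (bad : Fin m → View m → ℕ → Prop)
    (l k : ℕ) (hlk : k + (l + 1) = h) :
    ∃ P : List (Round M), P.length = 4 * D + 4 ∧
      ∀ (V : Fin M → View m) (p : ℕ), (∀ i, Bdd S (W + 1) (encView (V i))) → p < g ^ k →
        ∑ i, badCount bad g (g ^ h) (l + 1) p i (V i) < g ^ (l + 1) →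
        ∃ p' < g ^ (k + 1), ∑ i, badCount bad g (g ^ h) l p' i (V i) < g ^ l ∧
          Runs s' (W + 1) P (quiet fun i => encKnow (V i, p, []))
            (quiet fun i => encKnow (V i, p', [])) := by
  classical
  have hW : ∀ {j : ℕ}, j ≤ h → g ^ j < W := fun hj =>
    (Nat.pow_le_pow_right hg hj).trans_lt ((Nat.le_mul_of_pos_left _ hM).trans_lt hA)
  obtain ⟨P₁, hP₁, h₁⟩ := exists_local_superstep (M := M) (encKnow (m := m)) encKnow_injective
    (fun i a => (a.1, a.2.1, List.ofFn fun b : Fin g =>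
      badCount bad g (g ^ h) l (a.2.1 * g + b) i a.1)) s' (W + 1)
  obtain ⟨P₂, hP₂, h₂⟩ := exists_sum_all (m := m) (S := S) hg hM hD hA hs'
  -- All machines hold the same vector of sums, and hence choose the same digit.
  obtain ⟨P₃, hP₃, h₃⟩ := exists_local_superstep (M := M) (encKnow (m := m)) encKnow_injective
    (fun _ a => (a.1, a.2.1 * g + (if h : ∃ b : Fin g, a.2.2.getD b 0 < g ^ l then
      (h.choose : ℕ) else 0), [])) s' (W + 1)
  refine ⟨P₁ ++ P₂ ++ P₃, by simp only [List.length_append, hP₁, hP₂, hP₃]; omega,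
    fun V p hV hp hsum => ?_⟩
  have hex : ∃ b : Fin g, ∑ i, badCount bad g (g ^ h) l (p * g + b) i (V i) < g ^ l := by
    have : ∑ b : Fin g, ∑ i, badCount bad g (g ^ h) l (p * g + b) i (V i) <
        ∑ _b : Fin g, g ^ l := by
      rw [Finset.sum_comm]
      simp only [sum_badCount bad _ l p hg]
      simpa [pow_succ, mul_comm] using hsum
    obtain ⟨b, -, hb⟩ := Finset.exists_lt_of_sum_lt this
    exact ⟨b, hb⟩
  have hex' : ∃ b : Fin g, (List.ofFn fun b : Fin g => ∑ i, badCount bad g (g ^ h) l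
      (p * g + b) i (V i)).getD b 0 < g ^ l := by
    simpa only [getD_ofFn] using hex
  have hc := hex'.choose_spec
  rw [getD_ofFn] at hc
  have hp' : p * g + (hex'.choose : ℕ) < g ^ (k + 1) := by
    have h1 := hex'.choose.2
    have h2 : (p + 1) * g ≤ g ^ k * g := Nat.mul_le_mul_right _ hp
    rw [pow_succ]
    linarith
  refine ⟨_, hp', hc, ?_⟩
  have hpW : p < W := hp.trans (hW (by omega))
  have hbA : ∀ (i : Fin M) (b : Fin g), badCount bad g (g ^ h) l (p * g + b) i (V i) ≤ g ^ h :=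
    fun i b => badCount_le _ _ _ _ _ _ _
  have hlast := h₃ (fun i => (V i, p, List.ofFn fun b : Fin g => ∑ i, badCount bad g (g ^ h) l
    (p * g + b) i (V i))) ?_ ?_
  · simp only [dif_pos hex'] at hlast
    refine ((h₁ (fun i => (V i, p, [])) ?_ ?_).append (h₂ V p _ hV hpW hbA)).append hlast
    · exact fun i => bdd_encKnow (hV i) hpW (g := 0) (by simp [Bdd]) (by omega)
    · exact fun i => bdd_encKnow (hV i) hpW
        (bdd_ofFn fun b => (hbA i b).trans_lt (hW le_rfl)) (by omega)
  · refine fun i => bdd_encKnow (hV i) hpW (bdd_ofFn fun b => ?_) (by omega)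
    have := sum_subset_lt hA _ (fun i => hbA i b) (fun _ => True)
    simpa using this
  · intro i
    simp only [dif_pos hex']
    exact bdd_encKnow (hV i) (hp'.trans (hW (by omega))) (g := 0) (by simp [Bdd]) (by omega)

theorem exists_seed_search {m M g h S W s' D : ℕ} (hg : 0 < g) (hM : 0 < M) (hD : M ≤ g ^ D)
    (hA : M * g ^ h < W) (hs' : S + g + 3 + g * g ≤ s') (bad : Fin m → View m → ℕ → Prop)
    (l k : ℕ) (hlk : k + l = h) :
    ∃ P : List (Round M), P.length = l * (4 * D + 4) ∧
      ∀ (V : Fin M → View m) (p : ℕ), (∀ i, Bdd S (W + 1) (encView (V i))) → p < g ^ k →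
        ∑ i, badCount bad g (g ^ h) l p i (V i) < g ^ l →
        ∃ t < g ^ h, ∑ i, badCount bad g (g ^ h) 0 t i (V i) = 0 ∧
          Runs s' (W + 1) P (quiet fun i => encKnow (V i, p, []))
            (quiet fun i => encKnow (V i, t, [])) := by
  induction l generalizing k with
  | zero =>
    refine ⟨[], by simp, fun V p hV hp hsum => ?_⟩
    have hk : k = h := by omega
    rw [hk] at hp
    refine ⟨p, hp, by simpa using hsum, rfl, fun i => ?_⟩
    have hpW : p < W := hp.trans ((Nat.le_mul_of_pos_left _ hM).trans_lt hA)
    have h1 := bdd_encKnow (s := s') (hV i) hpW (l := []) (g := 0) (by simp [Bdd]) (by omega)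
    exact ⟨by simpa [quiet] using h1.1, by simp [quiet], h1.2, by simp [quiet]⟩
  | succ l ih =>
    obtain ⟨P, hP, h1⟩ := exists_next_digit (S := S) hg hM hD hA hs' bad l k hlk
    obtain ⟨P', hP', h2⟩ := ih (k + 1) (by omega)
    refine ⟨P ++ P', by rw [List.length_append, hP, hP']; ring, fun V p hV hp hsum => ?_⟩
    obtain ⟨p', hp', hsum', hrun⟩ := h1 V p hV hp hsum
    obtain ⟨t, ht, h0, hrun'⟩ := h2 V p' hV hp' hsum'
    exact ⟨t, ht, h0, hrun.append hrun'⟩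

/-- Derandomization of a procedure: there is a deterministic series of rounds that simulates the
procedure with random bits for which no node violates the strong success property.  The words of
the input are less than `W₀`, those of the machines, which also count seeds, are at most `W`. -/
theorem exists_rand_round {m M : ℕ} (hM : m ≤ M) (hm : 0 < m) (p : RandProc m) (q : Params)
    {d s W₀ W g h S s' D : ℕ} (hdW : d < W₀) (hmW : m ≤ W₀) (hW : 1 < W₀) (hWW : W₀ ≤ W)
    (hS : (d + 1) ^ (2 * q.τ) * (4 + d + s) ≤ S) (hN : 6 * m * (m + (W₀ + 1) * S) < g ^ h)
    (hg : 0 < g) (hD : M ≤ g ^ D) (hA : M * g ^ h < W) (hs' : S + g + 3 + g * g ≤ s')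
    (hs'' : S + 3 + d * S ≤ s') (hsmall : ∀ a, q.Small a → Bdd s W₀ a) :
    ∃ P : List (Round M), P.length = 2 * (2 * q.τ + 1) + h * (4 * D + 4) + 2 ∧
      ∀ (G : SimpleGraph (Fin m)) (x : State m), Tame d s W₀ G x → p.IsNormal q G x →
        ∃ ρ, (∀ v, p.ssp G (p.run G x ρ) v) ∧
          Runs s' (W + 1) P (quiet (place M (nodeInput G x)))
            (quiet (place M (nodeInput G (p.run G x ρ)))) := by
  classical
  have hdW' : d < W := hdW.trans_le hWW
  have hmW' : m ≤ W := hmW.trans hWW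
  have hW' : 1 < W := hW.trans_le hWW
  obtain ⟨ρ, hρ⟩ := exists_seeds p q hdW hmW hW hm hS hN
  obtain ⟨P₁, hP₁, h₁⟩ := exists_gather hM hdW' hmW' hW' (2 * q.τ) hS hs''
  obtain ⟨P₂, hP₂, h₂⟩ := exists_seed_search (S := S) (m := m) hg (hm.trans_le hM) hD hA hs'
    (ofView (2 * q.τ) fun G x v t => ¬ p.ssp G (p.run G x (ρ t)) v) h 0 (by omega)
  obtain ⟨P₃, hP₃, h₃⟩ := exists_finish (M := M) (s' := s') hdW' hmW' hW' hS (by omega)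
    (ofView (2 * q.τ) fun G x v t => p.run G x (ρ t) v)
  refine ⟨P₁ ++ P₂ ++ P₃, by simp only [List.length_append, hP₁, hP₂, hP₃],
    fun G x hx₀ hp => ?_⟩
  have hx : Tame d s W G x := hx₀.mono hWW
  have hl₁ : IsLocal (2 * q.τ) fun G x v t => ¬ p.ssp G (p.run G x (ρ t)) v := by
    intro G G' x x' v hv
    funext t
    exact congrArg Not
      (congrFun (p.isLocal_ssp_run hp.out_local hp.ssp_local G G' x x' v hv) (ρ t))
  have hl₂ : IsLocal (2 * q.τ) fun G x v t => p.run G x (ρ t) v := by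
    intro G G' x x' v hv
    funext t
    exact congrFun (((p.isLocal_run hp.out_local).mono (by omega)) G G' x x' v hv) (ρ t)
  have hcount : ∀ l t, ∑ i, badCount (ofView (2 * q.τ) fun G x v t =>
      ¬ p.ssp G (p.run G x (ρ t)) v) g (g ^ h) l t i (placeView M (2 * q.τ) G x i) =
      ∑ v : Fin m, ((Finset.range (g ^ h)).filter fun t' => t' / g ^ l = t ∧
        ¬ p.ssp G (p.run G x (ρ t')) v).card := by
    intro l t
    symm
    refine Finset.sum_of_injOn (Fin.castLE hM) (Fin.castLE_injective hM).injOn (by simp) ?_ ?_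
    · intro i _ hi
      rw [badCount, dif_neg]
      intro him
      exact hi ⟨⟨i, him⟩, by simp, rfl⟩
    · intro v _
      have hv : ((Fin.castLE hM v : Fin M) : ℕ) < m := v.2
      rw [badCount, dif_pos hv, placeView, dif_pos hv]
      simp only [ofView_view hl₁]
      rfl
  obtain ⟨t, ht, h0, hrun⟩ := h₂ (placeView M (2 * q.τ) G x) 0
    (fun i => hx.bdd_placeView hdW' hmW' hW' hS i) (by simp) (by
      rw [hcount]
      have hlt : ∀ v : Fin m, m * ((Finset.range (g ^ h)).filter fun t' => t' / g ^ h = 0 ∧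
          ¬ p.ssp G (p.run G x (ρ t')) v).card < g ^ h := by
        intro v
        refine lt_of_le_of_lt (Nat.mul_le_mul_left _ (Finset.card_le_card ?_)) (hρ G x hx₀ hp v)
        intro t ht
        rw [Finset.mem_filter] at ht ⊢
        exact ⟨ht.1, ht.2.2⟩
      have hne : (Finset.univ : Finset (Fin m)).Nonempty := ⟨⟨0, hm⟩, Finset.mem_univ _⟩
      have := Finset.sum_lt_sum_of_nonempty hne fun v _ => hlt v
      rw [← Finset.mul_sum] at this
      simp only [Finset.sum_const, Finset.card_univ, Fintype.card_fin, smul_eq_mul] at this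
      exact lt_of_mul_lt_mul_left this (Nat.zero_le _))
  have hssp : ∀ v, p.ssp G (p.run G x (ρ t)) v := by
    intro v
    by_contra hv
    rw [hcount, Finset.sum_eq_zero_iff] at h0
    have := h0 v (Finset.mem_univ _)
    rw [Finset.card_eq_zero] at this
    have hmem : t ∈ ((Finset.range (g ^ h)).filter fun t' => t' / g ^ 0 = t ∧
        ¬ p.ssp G (p.run G x (ρ t')) v) := by
      simp [ht, hv]
    rw [this] at hmem
    simp at hmem
  refine ⟨ρ t, hssp, ((h₁ G x hx).append hrun).append (h₃ G x _ t ?_ hx ?_ fun v => ?_)⟩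
  · exact ht.trans ((Nat.le_mul_of_pos_left _ (hm.trans_le hM)).trans_lt hA)
  · refine ⟨hx.1, fun v => ?_⟩
    obtain ⟨a, ha, -⟩ := hx.2 v
    have hr : p.run G x (ρ t) v = some (p.out G (fun u => (x u, ρ t u)) v) := by
      simp [RandProc.run, ha]
    exact ⟨_, hr, (hsmall _ (hp.out_small _ _ _ hr)).mono le_rfl hWW⟩
  · rw [ofView_view hl₂]

/-! ### Simulation of MPC rounds -/

/-- The contents of the machines during the simulation of `B`: every machine keeps the data of its
node in addition to the words kept by `B`. -/
def simConf {m : ℕ} (M : ℕ) (B : MPC m) (inp : Fin m → List ℕ) (t : ℕ) : MConf M := fun i =>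
  (encLists [place M inp i,
    if h : (i : ℕ) < B.machines then (B.conf inp t ⟨i, h⟩).1 else []],
   fun j => if h : (i : ℕ) < B.machines ∧ (j : ℕ) < B.machines then
    (B.conf inp t ⟨i, h.1⟩).2 ⟨j, h.2⟩ else [])

/-- The simulation of round `t` of `B`. -/
noncomputable def simRound {m M : ℕ} (B : MPC m) (hM : B.machines ≤ M) (t : ℕ) : Round M :=
  fun i c =>
    let o := (Function.invFun encLists c.1).getD 0 []
    let k := (Function.invFun encLists c.1).getD 1 []
    if h : (i : ℕ) < B.machines then
      (encLists [o, (B.step t ⟨i, h⟩ (k, fun j => c.2 (Fin.castLE hM j))).1],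
        fun j => if h' : (j : ℕ) < B.machines then
          (B.step t ⟨i, h⟩ (k, fun j => c.2 (Fin.castLE hM j))).2 ⟨j, h'⟩ else [])
    else (encLists [o, k], fun _ => [])

/-- The first round of the simulation of `B`. -/
def simInit {m M : ℕ} (B : MPC m) : Round M := fun i c =>
  (encLists [c.1, if (i : ℕ) < B.machines then c.1 else []], fun _ => [])

/-- The last round of the simulation, in which the nodes replace their information by the output
of `B`. -/
noncomputable def simFinish (m : ℕ) {M : ℕ} : Round M := fun i c =>
  (if (i : ℕ) < m then setInfo ((Function.invFun encLists c.1).getD 0 [])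
    (some ((Function.invFun encLists c.1).getD 1 [])) else [], fun _ => [])

theorem simRound_next {m M : ℕ} (B : MPC m) (hM : B.machines ≤ M) (inp : Fin m → List ℕ) (t : ℕ) :
    Round.next (simRound B hM t) (simConf M B inp t) = simConf M B inp (t + 1) := by
  have hdec : ∀ l, Function.invFun encLists (encLists l) = l :=
    Function.leftInverse_invFun encLists_injective
  have hmsg : ∀ (i : Fin M) (h : (i : ℕ) < B.machines),
      (fun j => (simConf M B inp t i).2 (Fin.castLE hM j)) = (B.conf inp t ⟨i, h⟩).2 := by
    intro i h
    funext j
    simp [simConf, h]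
  funext i
  refine Prod.ext ?_ ?_
  · by_cases h : (i : ℕ) < B.machines
    · simp only [Round.next, simRound, h, dif_pos, hmsg]
      simp [simConf, hdec, h, MPC.conf]
    · simp [Round.next, simRound, h, simConf, hdec]
  · funext j
    by_cases h : (j : ℕ) < B.machines
    · simp only [Round.next, simRound, h, dif_pos, hmsg]
      simp [simConf, hdec, h, MPC.conf]
    · simp [Round.next, simRound, h, simConf]

theorem sum_machines_le {M M' : ℕ} (hM : M' ≤ M) (f : Fin M → ℕ) (f' : Fin M' → ℕ)
    (h : ∀ j : Fin M', f (Fin.castLE hM j) = f' j) (h0 : ∀ j : Fin M, ¬ (j : ℕ) < M' → f j = 0) :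
    ∑ j, f j = ∑ j, f' j := by
  symm
  refine Finset.sum_of_injOn (Fin.castLE hM) (Fin.castLE_injective hM).injOn (by simp) ?_ fun j _ => (h j).symm
  intro i _ hi
  exact h0 i fun him => hi ⟨⟨i, him⟩, by simp, rfl⟩

theorem within_simConf {m M s₁ s₂ s' W W' : ℕ} {B : MPC m} (hM : B.machines ≤ M)
    {inp : Fin m → List ℕ} (hinp : ∀ i : Fin M, Bdd s₁ W' (place M inp i))
    (hB : B.FitsSpace inp s₂ W) (hs' : s₁ + 2 + s₂ ≤ s') (hW : W ≤ W') {t : ℕ}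
    (ht : t ≤ B.rounds) : Within s' (W' + 1) (simConf M B inp t) := by
  intro i
  by_cases h : (i : ℕ) < B.machines
  · obtain ⟨h1, h2, h3, h4⟩ := hB t ht ⟨i, h⟩
    have hk : Bdd (B.conf inp t ⟨i, h⟩).1.length W' (B.conf inp t ⟨i, h⟩).1 :=
      ⟨le_rfl, fun w hw => (h3 w hw).trans_le hW⟩
    have h5 := (hinp i).encLists_cons (hk.encLists_cons (t := 0) (l := []) (by simp [Bdd, encLists]))
    refine ⟨?_, ?_, ?_, ?_⟩
    · rw [sum_machines_le hM _ (fun j => ((B.conf inp t ⟨i, h⟩).2 j).length)]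
      · have := h5.1
        simp only [simConf, h, dif_pos]
        omega
      · intro j; simp [simConf, h]
      · intro j hj; simp [simConf, hj]
    · rw [sum_machines_le hM _ (fun j => ((B.conf inp t j).2 ⟨i, h⟩).length)]
      · omega
      · intro j; simp [simConf, h]
      · intro j hj; simp [simConf, hj]
    · simp only [simConf, h, dif_pos]
      exact h5.2
    · intro j w hw
      simp only [simConf, h, true_and] at hw
      split_ifs at hw
      · have := h4 _ w hw; omega
      · simp at hw
  · have h5 := (hinp i).encLists_cons (l := [[]]) (t := 1) (by simp [Bdd, encLists])
    refine ⟨?_, ?_, ?_, ?_⟩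
    · have := h5.1
      simp only [simConf, h, dif_neg, not_false_eq_true, false_and, List.length_nil,
        Finset.sum_const_zero]
      omega
    · simp [simConf, h]
    · simp only [simConf, h, dif_neg, not_false_eq_true]
      exact h5.2
    · simp [simConf, h]

theorem runs_simRounds {m M s' W : ℕ} {B : MPC m} (hM : B.machines ≤ M) {inp : Fin m → List ℕ}
    {T : ℕ} (h : ∀ t ≤ T, Within s' W (simConf M B inp t)) :
    Runs s' W ((List.range T).map (simRound B hM)) (simConf M B inp 0) (simConf M B inp T) := by
  induction T with
  | zero => exact ⟨rfl, h 0 le_rfl⟩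
  | succ T ih =>
    rw [List.range_succ, List.map_append]
    refine (ih fun t ht => h t (by omega)).append ⟨h T (by omega), ?_, ?_⟩
    · exact (simRound_next B hM inp T).symm
    · have := h (T + 1) le_rfl
      rwa [← simRound_next B hM] at this

/-- Simulation of a block of MPC rounds. -/
theorem exists_mpc_rounds {m M : ℕ} (B : MPC m) (hM : B.machines ≤ M) {d s W s₂ s' W₂ : ℕ}
    (hdW : d < W) (hmW : m ≤ W) (hW : 1 < W) (hW₂ : W₂ ≤ W) (hs' : 2 + d + s + 2 + s₂ ≤ s')
    (hs'' : 2 * (3 + d + s) ≤ s') :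
    ∃ P : List (Round M), P.length = B.rounds + 2 ∧
      ∀ (G : SimpleGraph (Fin m)) (x y : State m), Tame d s W G x → Tame d s W G y →
        B.FitsSpace (nodeInput G x) s₂ W₂ →
        (y = fun v => (x v).map fun _ => B.output (nodeInput G x) v) →
        Runs s' (W + 1) P (quiet (place M (nodeInput G x)))
          (quiet (place M (nodeInput G y))) := by
  have hdec : ∀ l, Function.invFun encLists (encLists l) = l :=
    Function.leftInverse_invFun encLists_injective
  have hwq : ∀ st : Fin M → List ℕ, (∀ i, Bdd s' (W + 1) (st i)) →
      Within s' (W + 1) (quiet st) := by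
    intro st h i
    exact ⟨by simpa [quiet] using (h i).1, by simp [quiet], (h i).2, by simp [quiet]⟩
  refine ⟨[simInit B] ++ (List.range B.rounds).map (simRound B hM) ++ [simFinish m],
    by simp, fun G x y hx hy hB hxy => ?_⟩
  have hx' := fun i => Tame.bdd_place (M := M) hx hdW hmW hW i
  have hy' := fun i => Tame.bdd_place (M := M) hy hdW hmW hW i
  have hw := fun t ht => within_simConf (t := t) hM hx' hB hs' hW₂ ht
  have hfirst : Round.next (simInit B) (quiet (place M (nodeInput G x))) =
      simConf M B (nodeInput G x) 0 := by
    funext i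
    by_cases h : (i : ℕ) < B.machines
    · simp [Round.next, quiet, simInit, simConf, h, MPC.conf, place]
    · simp [Round.next, quiet, simInit, simConf, h]
  have hlast : Round.next (simFinish m) (simConf M B (nodeInput G x) B.rounds) =
      quiet (place M (nodeInput G y)) := by
    funext i
    by_cases h : (i : ℕ) < m
    · have h' : (i : ℕ) < B.machines := h.trans_le B.le_machines
      obtain ⟨a, ha, -⟩ := hx.2 ⟨i, h⟩
      have hyi : y ⟨i, h⟩ = some (B.conf (nodeInput G x) B.rounds ⟨i, h'⟩).1 := by
        rw [hxy]
        simp [ha, MPC.output]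
      rw [Round.next, quiet]
      simp only [simFinish, simConf, hdec, h, h', dif_pos, if_true, place]
      simp only [List.getD_cons_zero, List.getD_cons_succ, ← hyi, setInfo_nodeInput]
    · simp [Round.next, quiet, simFinish, h, place]
  refine Runs.append (Runs.append (c' := simConf M B (nodeInput G x) 0) ?_
    (runs_simRounds hM hw)) ?_
  · refine ⟨hwq _ fun i => (hx' i).mono (by omega) (by omega), hfirst.symm, ?_⟩
    rw [hfirst]
    exact hw 0 (Nat.zero_le _)
  · refine ⟨hw _ le_rfl, hlast.symm, ?_⟩
    rw [hlast]
    exact hwq _ fun i => (hy' i).mono (by omega) (by omega)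

/-! ### Series of steps -/

/-- No node is deferred, and the information of every node is small. -/
def AllSmall {m : ℕ} (q : Params) (x : State m) : Prop := ∀ v, ∃ a, x v = some a ∧ q.Small a

theorem RandProc.IsNormal.allSmall_run {m : ℕ} {p : RandProc m} {q : Params}
    {G : SimpleGraph (Fin m)} {x : State m} (h : p.IsNormal q G x) (hx : AllSmall q x)
    (ρ : Fin m → Fin p.bits → Bool) : AllSmall q (p.run G x ρ) := by
  intro v
  obtain ⟨a, ha, -⟩ := hx v
  have hr : p.run G x ρ v = some (p.out G (fun u => (x u, ρ u)) v) := by simp [RandProc.run, ha]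
  exact ⟨_, hr, h.out_small _ _ _ hr⟩

/-- If no node violates the strong success property, then nothing has to be deferred. -/
theorem RandProc.IsNormal.trans_run {m : ℕ} {p : RandProc m} {q : Params}
    {G : SimpleGraph (Fin m)} {x : State m} (h : p.IsNormal q G x) (hx : AllSmall q x)
    {ρ : Fin m → Fin p.bits → Bool} (hρ : ∀ v, p.ssp G (p.run G x ρ) v) :
    (Step.rand p).Trans G x (p.run G x ρ) := by
  have h0 : {u | ¬ p.ssp G (p.run G x ρ) u} = ∅ := by
    ext u
    simp [hρ u]
  have hd : defer (p.run G x ρ) ∅ = p.run G x ρ := by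
    funext v
    simp [defer]
  refine ⟨ρ, ∅, hd.symm, fun v _ => ?_⟩
  obtain ⟨a, ha, -⟩ := hx v
  have := h.ssp_imp_wsp ρ v (by simp [ha]) (hρ v)
  rwa [h0, hd] at this

theorem RandProc.IsNormal.exists_ssp {m : ℕ} (hm : 0 < m) {p : RandProc m} {q : Params}
    {G : SimpleGraph (Fin m)} {x : State m} (h : p.IsNormal q G x) (hx : AllSmall q x) :
    ∃ ρ, ∀ v, p.ssp G (p.run G x ρ) v := by
  classical
  by_contra! hcon
  have h1 : (Finset.univ : Finset (Fin m → Fin p.bits → Bool)) ⊆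
      Finset.univ.biUnion fun v => Finset.univ.filter fun ρ => ¬ p.ssp G (p.run G x ρ) v := by
    intro ρ _
    obtain ⟨v, hv⟩ := hcon ρ
    simp only [Finset.mem_biUnion, Finset.mem_filter, Finset.mem_univ, true_and]
    exact ⟨v, hv⟩
  have h2 := (Finset.card_le_card h1).trans Finset.card_biUnion_le
  have h3 : ∑ v : Fin m, 2 * m * (Finset.univ.filter fun ρ => ¬ p.ssp G (p.run G x ρ) v).card ≤
      ∑ _v : Fin m, Fintype.card (Fin m → Fin p.bits → Bool) := by
    refine Finset.sum_le_sum fun v _ => ?_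
    obtain ⟨a, ha, -⟩ := hx v
    convert h.card_bad_le (v := v) (by simp [ha])
  rw [← Finset.mul_sum, Finset.sum_const, Finset.card_univ, Fintype.card_fin, smul_eq_mul] at h3
  have hpos : 0 < Fintype.card (Fin m → Fin p.bits → Bool) := Fintype.card_pos
  rw [Finset.card_univ] at h2
  have h4 := (Nat.mul_le_mul_left (2 * m) h2).trans h3
  have h5 : 0 < m * Fintype.card (Fin m → Fin p.bits → Bool) := Nat.mul_pos hm hpos
  rw [mul_assoc] at h4
  omega

theorem Step.Good.exists_trans {m : ℕ} (hm : 0 < m) {q : Params} {G : SimpleGraph (Fin m)}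
    {x : State m} {σ : Step m} (h : σ.Good q G x) (hx : AllSmall q x) :
    ∃ y, σ.Trans G x y ∧ AllSmall q y := by
  have hsome : ∀ v, x v ≠ none := fun v => by
    obtain ⟨a, ha, -⟩ := hx v
    simp [ha]
  have hmap : ∀ f : Fin m → List ℕ, (∀ v, q.Small (f v)) →
      AllSmall q fun v => (x v).map fun _ => f v := by
    intro f hf v
    obtain ⟨a, ha, -⟩ := hx v
    exact ⟨f v, by simp [ha], hf v⟩
  cases σ with
  | rand p =>
    obtain ⟨ρ, hρ⟩ := RandProc.IsNormal.exists_ssp hm h hx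
    exact ⟨_, RandProc.IsNormal.trans_run h hx hρ, RandProc.IsNormal.allSmall_run h hx ρ⟩
  | loc f => exact ⟨_, rfl, hmap _ fun v => h.2 v (hsome v)⟩
  | mpc B => exact ⟨_, rfl, hmap _ fun v => h.2.2 v (hsome v)⟩

/-- Some execution of the series of steps defers no node. -/
theorem exists_reach {m : ℕ} (hm : 0 < m) {q : Params} {G : SimpleGraph (Fin m)}
    (A : List (Step m)) (x : State m) (hx : AllSmall q x)
    (hgood : ∀ (pre post : List (Step m)) (σ : Step m), A = pre ++ σ :: post →
      ∀ z, Reach G x pre z → σ.Good q G z) :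
    ∃ y, Reach G x A y ∧ AllSmall q y := by
  induction A generalizing x with
  | nil => exact ⟨x, rfl, hx⟩
  | cons σ A ih =>
    obtain ⟨z, hz, hzs⟩ := (hgood [] A σ rfl x rfl).exists_trans hm hx
    obtain ⟨y, hy, hys⟩ := ih z hzs fun pre post σ' h z' hz' =>
      hgood (σ :: pre) post σ' (by rw [h]; rfl) z' ⟨z, hz, hz'⟩
    exact ⟨y, ⟨z, hz, hy⟩, hys⟩

/-- If every step can be simulated by deterministic rounds without deferring any node, then so can
a series of steps. -/
theorem exists_rounds_of_steps {m M s' W K : ℕ} {q : Params}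
    (hstep : ∀ σ : Step m, ∃ P : List (Round M),
      P.length ≤ K * (σ.randCount * q.τ + σ.detCount) ∧
      ∀ (G : SimpleGraph (Fin m)) (x : State m), MaxDegLE G q.Δ → AllSmall q x → σ.Good q G x →
        ∃ y, σ.Trans G x y ∧ AllSmall q y ∧ Runs s' W P (quiet (place M (nodeInput G x)))
          (quiet (place M (nodeInput G y))))
    (hwithin : ∀ (G : SimpleGraph (Fin m)) (x : State m), MaxDegLE G q.Δ → AllSmall q x →
      Within s' W (quiet (place M (nodeInput G x))))
    (A : List (Step m)) :
    ∃ P : List (Round M),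
      P.length ≤ K * ((A.map Step.randCount).sum * q.τ + (A.map Step.detCount).sum) ∧
      ∀ (G : SimpleGraph (Fin m)) (x : State m), MaxDegLE G q.Δ → AllSmall q x →
        (∀ (pre post : List (Step m)) (σ : Step m), A = pre ++ σ :: post →
          ∀ z, Reach G x pre z → σ.Good q G z) →
        ∃ y, Reach G x A y ∧ AllSmall q y ∧ Runs s' W P (quiet (place M (nodeInput G x)))
          (quiet (place M (nodeInput G y))) := by
  induction A with
  | nil => exact ⟨[], by simp, fun G x hG hx _ => ⟨x, rfl, hx, rfl, hwithin G x hG hx⟩⟩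
  | cons σ A ih =>
    obtain ⟨P₁, hP₁, h₁⟩ := hstep σ
    obtain ⟨P₂, hP₂, h₂⟩ := ih
    refine ⟨P₁ ++ P₂, ?_, fun G x hG hx hgood => ?_⟩
    · rw [List.length_append, List.map_cons, List.map_cons, List.sum_cons, List.sum_cons]
      linarith
    · obtain ⟨z, hz, hzs, hr₁⟩ := h₁ G x hG hx (hgood [] A σ rfl x rfl)
      obtain ⟨y, hy, hys, hr₂⟩ := h₂ G z hG hzs fun pre post σ' h z' hz' =>
        hgood (σ :: pre) post σ' (by rw [h]; rfl) z' ⟨z, hz, hz'⟩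
      exact ⟨y, ⟨z, hz, hy⟩, hys, hr₁.append hr₂⟩

/-! ### Parameters -/

/-- There is a deterministic MPC algorithm for `P` on `m`-node graphs whose number of rounds and
space obey the bounds for the parameters `q` with the hidden constant `K`. -/
def Derandomizable (P : GraphProblem) (q : Params) (m K : ℕ) : Prop :=
  ∃ (B : MPC m) (s : ℕ),
    B.rounds ≤ K * (q.k * q.τ + logStar m) ∧
    (s : ℝ) ≤ K * q.space ∧
    (B.machines : ℝ) * s ≤ K * (m * q.space) ∧
    ∀ (G : SimpleGraph (Fin m)) (IN : Fin m → List ℕ),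
      MaxDegLE G q.Δ → P.IsInstance G IN → (∀ v, q.Small (IN v)) →
      B.FitsSpace (nodeInput G (fun v => some (IN v))) s ((q.n + 2) ^ K) ∧
      P.IsSolution G IN (B.output (nodeInput G (fun v => some (IN v))))

theorem Params.space_nonneg (q : Params) : 0 ≤ q.space := Real.rpow_nonneg (by positivity) _

theorem Derandomizable.mono {P : GraphProblem} {q : Params} {m K K' : ℕ}
    (h : Derandomizable P q m K) (hK : K ≤ K') : Derandomizable P q m K' := by
  obtain ⟨B, s, h1, h2, h3, h4⟩ := h
  have hK' : (K : ℝ) ≤ K' := by exact_mod_cast hK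
  refine ⟨B, s, h1.trans (Nat.mul_le_mul_right _ hK),
    h2.trans (mul_le_mul_of_nonneg_right hK' q.space_nonneg),
    h3.trans (mul_le_mul_of_nonneg_right hK' (mul_nonneg (by positivity) q.space_nonneg)),
    fun G IN hG hP hIN => ?_⟩
  obtain ⟨h5, h6⟩ := h4 G IN hG hP hIN
  refine ⟨fun t ht i => ?_, h6⟩
  obtain ⟨h7, h8, h9, h10⟩ := h5 t ht i
  have hW : (q.n + 2) ^ K ≤ (q.n + 2) ^ K' := Nat.pow_le_pow_right (by omega) hK
  exact ⟨h7, h8, fun w hw => (h9 w hw).trans_le hW, fun j w hw => (h10 j w hw).trans_le hW⟩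

theorem Params.space_eq (q : Params) : q.space = (q.Δ ^ q.τ) ^ q.C := by
  have h0 : (0 : ℝ) ≤ q.n := by positivity
  rw [Params.space, Params.Δ, Real.rpow_mul h0, Real.rpow_mul h0, Real.rpow_natCast,
    Real.rpow_natCast]

theorem Params.one_le_Δ {q : Params} (hn : 1 ≤ q.n) (hδ : 0 < q.δ) : 1 ≤ q.Δ :=
  Real.one_le_rpow (by exact_mod_cast hn) (by positivity)

theorem Params.Small.bdd {q : Params} {a : List ℕ} (h : q.Small a) {s W : ℕ}
    (hs : q.c * q.Δ ^ q.τ ≤ s) (hW : (q.n + 2) ^ q.c ≤ W) : Bdd s W a :=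
  ⟨by exact_mod_cast h.1.trans hs, fun w hw => (h.2 w hw).trans_le hW⟩

/-! ### Machines that can store the whole graph -/

theorem IsNormalAlgorithm.exists_solution {P : GraphProblem} {q : Params} {m : ℕ}
    {A : List (Step m)} (h : IsNormalAlgorithm P q A) (hm : 0 < m) {G : SimpleGraph (Fin m)}
    {IN : Fin m → List ℕ} (hG : MaxDegLE G q.Δ) (hP : P.IsInstance G IN)
    (hIN : ∀ v, q.Small (IN v)) : ∃ L, P.IsSolution G IN L ∧ ∀ v, q.Small (L v) := by
  obtain ⟨y, hy, hys⟩ := exists_reach hm A (fun v => some (IN v)) (fun v => ⟨_, rfl, hIN v⟩)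
    (h.good G IN hG hP hIN)
  obtain ⟨L, hL, hLy⟩ := h.final G IN hG hP hIN y hy
  refine ⟨L, hL, fun v => ?_⟩
  obtain ⟨a, ha, hs⟩ := hys v
  rwa [hLy v a ha]

/-- If `Δ ^ τ ≥ n`, then a machine can store the whole graph, and hence compute a solution. -/
theorem derandomizable_of_le {P : GraphProblem} {q : Params} {m : ℕ} (hm : 1 ≤ m) (hmn : m ≤ q.n)
    (hτ : 1 ≤ q.τ) (hk : 1 ≤ q.k) (hC : 2 ≤ q.C) (hn : (q.n : ℝ) ≤ q.Δ ^ q.τ) {A : List (Step m)}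
    (hA : IsNormalAlgorithm P q A) : Derandomizable P q m (2 * (q.c + 3)) := by
  classical
  set X : ℝ := q.Δ ^ q.τ with hX
  have hX1 : (1 : ℝ) ≤ X := le_trans (by exact_mod_cast hm.trans hmn) hn
  have hmX : (m : ℝ) ≤ X := le_trans (by exact_mod_cast hmn) hn
  set s₁ := 2 + m + ⌊(q.c : ℝ) * X⌋₊ with hs₁
  have hs₁X : (s₁ : ℝ) ≤ (q.c + 3) * X := by
    have h1 : ((⌊(q.c : ℝ) * X⌋₊ : ℕ) : ℝ) ≤ q.c * X := Nat.floor_le (by positivity)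
    rw [hs₁]
    push_cast
    linarith
  have hspace : X ^ 2 ≤ q.space := by
    rw [Params.space_eq]
    exact pow_le_pow_right₀ hX1 hC
  have hsX : ((s₁ + m * s₁ : ℕ) : ℝ) ≤ 2 * (q.c + 3) * X ^ 2 := by
    have h1 : (s₁ : ℝ) * (1 + m) ≤ ((q.c + 3) * X) * (2 * X) :=
      mul_le_mul hs₁X (by linarith) (by positivity) (by positivity)
    push_cast
    linarith
  have hs : ((s₁ + m * s₁ : ℕ) : ℝ) ≤ (2 * (q.c + 3) : ℕ) * q.space := by
    push_cast at hsX ⊢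
    exact hsX.trans (mul_le_mul_of_nonneg_left hspace (by positivity))
  set W := (q.n + 2) ^ (q.c + 1) with hW
  have hnW : q.n + 2 ≤ W := Nat.le_self_pow (by omega) _
  let prog : List (Round m) := superstep (id : List ℕ → List ℕ) (id : List ℕ → List ℕ)
    (fun _ l _ => l)
    fun i _ msg => if h : ∃ g : SimpleGraph (Fin m) × (Fin m → List ℕ) × (Fin m → List ℕ),
      (∀ j, nodeInput g.1 (fun v => some (g.2.1 v)) j = msg j) ∧ P.IsSolution g.1 g.2.1 g.2.2 ∧
        ∀ v, q.Small (g.2.2 v) then h.choose.2.2 i else []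
  refine ⟨MPC.ofRounds le_rfl prog, s₁ + m * s₁, ?_, hs, ?_, fun G IN hG hP hIN => ?_⟩
  · have : 1 * 1 ≤ q.k * q.τ := Nat.mul_le_mul hk hτ
    have h2 : 2 * 1 ≤ 2 * (q.c + 3) * (q.k * q.τ + logStar m) :=
      Nat.mul_le_mul (by omega) (by omega)
    exact h2
  · have := mul_le_mul_of_nonneg_left hs (by positivity : (0 : ℝ) ≤ m)
    calc _ ≤ _ := this
      _ = _ := by ring
  · obtain ⟨L, hL, hLs⟩ := hA.exists_solution hm hG hP hIN
    have hsmall : ∀ a, q.Small a → Bdd ⌊(q.c : ℝ) * X⌋₊ W a := by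
      intro a ha
      exact ⟨Nat.le_floor ha.1, fun w hw => (ha.2 w hw).trans_le
        (Nat.pow_le_pow_right (by omega) (by omega))⟩
    have hin : ∀ v, Bdd s₁ W (nodeInput G (fun v => some (IN v)) v) := fun v =>
      bdd_nodeInput (d := m) ((Set.ncard_le_card _).trans (by simp)) rfl (hsmall _ (hIN v))
        (by omega) (by omega) (by omega)
    have hex : ∃ g : SimpleGraph (Fin m) × (Fin m → List ℕ) × (Fin m → List ℕ),
        (∀ j, nodeInput g.1 (fun v => some (g.2.1 v)) j =
          nodeInput G (fun v => some (IN v)) j) ∧ P.IsSolution g.1 g.2.1 g.2.2 ∧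
        ∀ v, q.Small (g.2.2 v) := ⟨(G, IN, L), fun _ => rfl, hL, hLs⟩
    obtain ⟨h1, h2, h3⟩ := hex.choose_spec
    have hGe : hex.choose.1 = G := by
      ext u v
      exact adj_iff_of_nodeInput_eq (h1 u) v
    have hINe : hex.choose.2.1 = IN := by
      funext v
      simpa using info_eq_of_nodeInput_eq (h1 v)
    rw [hGe, hINe] at h2
    have hplace : place m (nodeInput G fun v => some (IN v)) =
        nodeInput G fun v => some (IN v) := by
      funext i
      simp [place]
    have hrun : Runs (s₁ + m * s₁) W prog (quiet (place m (nodeInput G fun v => some (IN v))))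
        (quiet hex.choose.2.2) := by
      rw [hplace]
      refine runs_superstep (s₁ := s₁) (s₂ := m * s₁) (st' := hex.choose.2.2)
        Function.injective_id le_rfl ?_ hin ?_ ?_ ?_ ?_
      · intro i
        exact dif_pos hex
      · intro i
        rw [Finset.sum_const, Finset.card_univ, Fintype.card_fin, smul_eq_mul]
        exact Nat.mul_le_mul_left m (hin i).1
      · intro i
        exact (Finset.sum_le_card_nsmul _ _ s₁ fun j _ => (hin j).1).trans (by simp)
      · exact fun i _ => (hin i).2
      · exact fun i => (hsmall _ (h3 i)).mono (by omega) le_rfl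
    constructor
    · have h5 := MPC.fitsSpace_of_runs le_rfl prog _ _ hrun
      have hWK : W ≤ (q.n + 2) ^ (2 * (q.c + 3)) := Nat.pow_le_pow_right (by omega) (by omega)
      intro t ht i
      obtain ⟨h7, h8, h9, h10⟩ := h5 t ht i
      exact ⟨h7, h8, fun w hw => (h9 w hw).trans_le hWK, fun j w hw => (h10 j w hw).trans_le hWK⟩
    · have : (MPC.ofRounds le_rfl prog).output (nodeInput G fun v => some (IN v)) =
          hex.choose.2.2 := by
        funext v
        rw [MPC.output_of_runs le_rfl prog _ _ hrun]
        rfl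
      rw [this]
      exact h2

/-! ### Machines that can store neighbourhoods only -/

theorem AllSmall.tame {m : ℕ} {q : Params} {G : SimpleGraph (Fin m)} {x : State m}
    (hx : AllSmall q x) (hG : MaxDegLE G q.Δ) {s W : ℕ} (h : ∀ a, q.Small a → Bdd s W a) :
    Tame ⌊q.Δ⌋₊ s W G x :=
  ⟨fun v => Nat.le_floor (hG v), fun v => let ⟨a, h1, h2⟩ := hx v; ⟨a, h1, h a h2⟩⟩

/-- Derandomization for given natural numbers that bound the quantities involved: `d` the degrees,
`s` the information of a node, `W₀` its words, `S` the neighbourhoods of radius `2 τ`; `g` is the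
arity of the tree and the number of values of a digit of a seed, `h` the number of digits, `D` the
height of the tree, and `s'` and `W` bound the space and the words of the machines. -/
theorem derandomizable_of_bounds {P : GraphProblem} {q : Params} {m : ℕ} (hm : 1 ≤ m)
    (hτ : 1 ≤ q.τ) (hk : 1 ≤ q.k) {s W₀ W g h S s' D K : ℕ}
    (hdW : ⌊q.Δ⌋₊ < W₀) (hmW : m ≤ W₀) (hW₀ : 1 < W₀) (hWW : W₀ ≤ W) (hcW : (q.n + 2) ^ q.c ≤ W₀)
    (hs : q.c * q.Δ ^ q.τ ≤ s)
    (hS : (⌊q.Δ⌋₊ + 1) ^ (2 * q.τ) * (4 + ⌊q.Δ⌋₊ + s) ≤ S)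
    (hN : 6 * m * (m + (W₀ + 1) * S) < g ^ h)
    (hg : 0 < g) (hD : (q.c + 1) * m ≤ g ^ D) (hA : (q.c + 1) * m * g ^ h < W)
    (hs₁ : S + g + 3 + g * g ≤ s') (hs₂ : S + 3 + ⌊q.Δ⌋₊ * S ≤ s')
    (hs₃ : S + ⌊q.c * q.space⌋₊ ≤ s') (hs₄ : 2 * S ≤ s')
    (hK : (10 + h * (4 * D + 4)) * (q.c + 1) + 2 ≤ K) (hWK : W + 1 ≤ (q.n + 2) ^ K)
    (hsK : (q.c + 1) * (s' : ℝ) ≤ K * q.space)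
    {A : List (Step m)} (hAlg : IsNormalAlgorithm P q A) : Derandomizable P q m K := by
  have hmM : m ≤ (q.c + 1) * m := Nat.le_mul_of_pos_left _ (by omega)
  have hsmall₀ : ∀ a, q.Small a → Bdd s W₀ a := fun a ha => ha.bdd hs hcW
  have hsmall : ∀ a, q.Small a → Bdd s W a := fun a ha => (hsmall₀ a ha).mono le_rfl hWW
  have hdW' : ⌊q.Δ⌋₊ < W := hdW.trans_le hWW
  have hmW' : m ≤ W := hmW.trans hWW
  have hW : 1 < W := hW₀.trans_le hWW
  have hS₁ : (⌊q.Δ⌋₊ + 1) ^ 1 * (4 + ⌊q.Δ⌋₊ + s) ≤ S :=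
    le_trans (Nat.mul_le_mul_right _ (Nat.pow_le_pow_right (by omega) (by omega))) hS
  have hS₀ : 4 + ⌊q.Δ⌋₊ + s ≤ S :=
    le_trans (Nat.le_mul_of_pos_left _ (Nat.pow_pos (by omega))) hS₁
  have hplace : ∀ (G : SimpleGraph (Fin m)) (x : State m), MaxDegLE G q.Δ → AllSmall q x →
      ∀ i : Fin ((q.c + 1) * m), Bdd s' (W + 1) (place _ (nodeInput G x) i) := fun G x hG hx i =>
    (Tame.bdd_place (hx.tame hG hsmall) hdW' hmW' hW i).mono (by omega) (by omega)
  obtain ⟨P₁, hP₁, h₁⟩ := exists_rounds_of_steps (m := m) (M := (q.c + 1) * m) (s' := s')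
    (W := W + 1) (K := 10 + h * (4 * D + 4)) (q := q) (by
      intro σ
      cases σ with
      | rand p =>
        obtain ⟨P, hP, hrun⟩ := exists_rand_round hmM hm p q hdW hmW hW₀ hWW hS hN hg hD hA hs₁
          hs₂ hsmall₀
        refine ⟨P, ?_, fun G x hG hx hp => ?_⟩
        · have h1 : h * (4 * D + 4) * 1 ≤ h * (4 * D + 4) * q.τ := Nat.mul_le_mul_left _ hτ
          have h2 : (10 + h * (4 * D + 4)) * (1 * q.τ + 0) =
            10 * q.τ + h * (4 * D + 4) * q.τ := by ring
          simp only [Step.randCount, Step.detCount]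
          omega
        · obtain ⟨ρ, hρ, hr⟩ := hrun G x (hx.tame hG hsmall₀) hp
          exact ⟨_, RandProc.IsNormal.trans_run hp hx hρ, RandProc.IsNormal.allSmall_run hp hx ρ,
            hr⟩
      | loc f =>
        obtain ⟨P, hP, hrun⟩ := exists_local_round hmM hdW' hmW' hW hS₁ hs₂ f
        refine ⟨P, ?_, fun G x hG hx hp => ?_⟩
        · simp only [Step.randCount, Step.detCount]
          omega
        · obtain ⟨y, hy, hys⟩ := Step.Good.exists_trans hm hp hx
          exact ⟨y, hy, hys, hrun G x y (hx.tame hG hsmall) (hys.tame hG hsmall) hp.1 hy⟩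
      | mpc B =>
        by_cases hB : B.machines ≤ (q.c + 1) * m
        · obtain ⟨P, hP, hrun⟩ := exists_mpc_rounds (s := s) (s₂ := ⌊q.c * q.space⌋₊) (s' := s') B hB hdW'
            hmW' hW (hcW.trans hWW) (by omega) (by omega)
          refine ⟨P, ?_, fun G x hG hx hp => ?_⟩
          · have h1 : 10 * max B.rounds 1 ≤ (10 + h * (4 * D + 4)) * max B.rounds 1 :=
              Nat.mul_le_mul_right _ (by omega)
            simp only [Step.randCount, Step.detCount, zero_mul, zero_add]
            omega
          · obtain ⟨y, hy, hys⟩ := Step.Good.exists_trans hm hp hx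
            exact ⟨y, hy, hys,
              hrun G x y (hx.tame hG hsmall) (hys.tame hG hsmall) hp.2.1 hy⟩
        · refine ⟨[], by simp, fun G x hG hx hp => absurd (hp.1.trans ?_) hB⟩
          exact Nat.mul_le_mul_right _ (by omega))
    (fun G x hG hx i => ⟨by simpa [quiet] using (hplace G x hG hx i).1, by simp [quiet],
      (hplace G x hG hx i).2, by simp [quiet]⟩) A
  obtain ⟨P₂, hP₂, h₂⟩ := exists_local_superstep (M := (q.c + 1) * m) (enc := id)
    (id : List ℕ → List ℕ) Function.injective_id (fun _ l => getInfo l) s' (W + 1)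
  refine ⟨MPC.ofRounds hmM (P₁ ++ P₂), s', ?_, ?_, ?_, fun G IN hG hP hIN => ?_⟩
  · have h1 : 1 * 1 ≤ q.k * q.τ := Nat.mul_le_mul hk hτ
    have h2 : (A.map Step.randCount).sum * q.τ + (A.map Step.detCount).sum ≤
        (q.c + 1) * (q.k * q.τ + logStar m) := by
      have h3 := Nat.mul_le_mul_right q.τ hAlg.rand_le
      have h4 := hAlg.det_le
      nlinarith
    have h3 := hP₁.trans (Nat.mul_le_mul_left _ h2)
    have h4 := Nat.mul_le_mul_right (q.k * q.τ + logStar m) hK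
    have h5 : (MPC.ofRounds hmM (P₁ ++ P₂)).rounds = P₁.length + 2 := by
      rw [← hP₂, ← List.length_append]
      rfl
    rw [h5]
    have h6 : ((10 + h * (4 * D + 4)) * (q.c + 1) + 2) * (q.k * q.τ + logStar m) =
      (10 + h * (4 * D + 4)) * ((q.c + 1) * (q.k * q.τ + logStar m)) +
        2 * (q.k * q.τ + logStar m) := by ring
    omega
  · refine le_trans ?_ hsK
    have : (0 : ℝ) ≤ q.c * (s' : ℝ) := by positivity
    linarith
  · have h1 := mul_le_mul_of_nonneg_left hsK (by positivity : (0 : ℝ) ≤ m)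
    have h2 : (((MPC.ofRounds hmM (P₁ ++ P₂)).machines : ℕ) : ℝ) = (q.c + 1) * m := by
      simp [MPC.ofRounds]
    rw [h2]
    calc ((q.c : ℝ) + 1) * m * s' = m * ((q.c + 1) * s') := by ring
      _ ≤ m * (K * q.space) := h1
      _ = K * (m * q.space) := by ring
  · have hx : AllSmall q fun v => some (IN v) := fun v => ⟨_, rfl, hIN v⟩
    obtain ⟨y, hy, hys, hr₁⟩ := h₁ G _ hG hx (hAlg.good G IN hG hP hIN)
    obtain ⟨L, hL, hLy⟩ := hAlg.final G IN hG hP hIN y hy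
    have hLe : ∀ v, getInfo (nodeInput G y v) = L v := by
      intro v
      obtain ⟨a, ha, -⟩ := hys v
      rw [getInfo_nodeInput ha, hLy v a ha]
    have hr₂ := h₂ (place _ (nodeInput G y)) (hplace G y hG hys) fun i => by
      have := hplace G y hG hys i
      exact ⟨(by simp [getInfo] : (getInfo _).length ≤ _).trans this.1,
        fun w hw => this.2 w (List.mem_of_mem_drop hw)⟩
    have hrun := hr₁.append hr₂
    constructor
    · intro t ht i
      obtain ⟨h7, h8, h9, h10⟩ := MPC.fitsSpace_of_runs hmM _ _ _ hrun t ht i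
      exact ⟨h7, h8, fun w hw => (h9 w hw).trans_le hWK, fun j w hw => (h10 j w hw).trans_le hWK⟩
    · have : (MPC.ofRounds hmM (P₁ ++ P₂)).output (nodeInput G fun v => some (IN v)) = L := by
        funext v
        rw [MPC.output_of_runs hmM _ _ _ hrun, ← hLe v]
        simp [place]
      rw [this]
      exact hL

/-- If `Δ ^ τ < n`, then `τ` is bounded by a constant, and all quantities are polynomial in `n`. -/
theorem exists_derandomizable_of_lt (δ : ℝ) (hδ : 0 < δ) (c : ℕ) :
    ∃ K : ℕ, ∀ (P : GraphProblem) (n τ k m : ℕ), 1 ≤ m → m ≤ n → 1 ≤ τ → 1 ≤ k →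
      7 * δ * τ < 1 → ∀ A : List (Step m), IsNormalAlgorithm P ⟨n, τ, k, c, 5, δ⟩ A →
      Derandomizable P ⟨n, τ, k, c, 5, δ⟩ m K := by
  obtain ⟨T, hT⟩ := exists_nat_ge (1 / (7 * δ))
  have hT' : 1 ≤ 7 * δ * T := by
    rw [div_le_iff₀ (by positivity)] at hT
    linarith
  -- `n + 2 ≤ g ^ (T + 2)`, the number of seeds exceeds `(n + 2) ^ E`, and there are at most
  -- `(n + 2) ^ (c + 2)` machines.
  set E := 2 * c + 11 + 3 * T with hE
  set h := (T + 2) * E with hh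
  set D := (T + 2) * (c + 2) with hD
  set K := (10 + h * (4 * D + 4)) * (c + 1) + 2 + (c + h + 4) +
    (c + 1) * ((2 * c + 12) * 3 ^ (4 * T) + c) with hK
  refine ⟨K, fun P n τ k m hm hmn hτ hk hτδ A hA => ?_⟩
  set q : Params := ⟨n, τ, k, c, 5, δ⟩ with hq
  have hn : (1 : ℝ) ≤ n := by exact_mod_cast hm.trans hmn
  have hΔ1 : 1 ≤ q.Δ := Params.one_le_Δ (hm.trans hmn) hδ
  have hτ' : (1 : ℝ) ≤ τ := by exact_mod_cast hτ
  have hΔn : q.Δ ≤ n := by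
    have : q.Δ ≤ (n : ℝ) ^ (1 : ℝ) := Real.rpow_le_rpow_of_exponent_le hn (by
      simp only [hq]; nlinarith)
    simpa using this
  have hτT : τ ≤ T := by
    have : 7 * δ * τ ≤ 7 * δ * T := by linarith
    exact_mod_cast le_of_mul_le_mul_left this (by positivity)
  set d := ⌊q.Δ⌋₊ with hd
  set g := d + 2 with hg
  have hdn : d ≤ n := by
    have : (d : ℝ) ≤ n := (Nat.floor_le (by linarith)).trans hΔn
    exact_mod_cast this
  have hgn : g ≤ n + 2 := by omega
  have hΔg : q.Δ ≤ g := by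
    have := Nat.lt_floor_add_one q.Δ
    rw [hg]
    push_cast
    linarith
  have hgΔ : (g : ℝ) ≤ 3 * q.Δ := by
    have : (d : ℝ) ≤ q.Δ := Nat.floor_le (by linarith)
    rw [hg]
    push_cast
    linarith
  have hg1 : ∀ e, 1 ≤ g ^ e := fun e => Nat.one_le_pow _ _ (by omega)
  have hgτ : g ≤ g ^ τ := Nat.le_self_pow (by omega) _
  have hgT : n + 2 ≤ g ^ (T + 2) := by
    have h1 : (n : ℝ) ≤ (g : ℝ) ^ T := by
      calc (n : ℝ) = (n : ℝ) ^ (1 : ℝ) := (Real.rpow_one _).symm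
        _ ≤ (n : ℝ) ^ (7 * δ * T) := Real.rpow_le_rpow_of_exponent_le hn hT'
        _ = q.Δ ^ T := by rw [Real.rpow_mul (by positivity), Real.rpow_natCast]; rfl
        _ ≤ _ := by gcongr
    have h1' : n ≤ g ^ T := by exact_mod_cast h1
    have h2 : 2 ^ 2 ≤ g ^ 2 := Nat.pow_le_pow_left (by omega) 2
    rw [pow_add]
    have h3 := Nat.mul_le_mul h1' h2
    omega
  set s := c * g ^ τ with hs
  set S := g ^ (2 * τ) * (4 + d + s) with hS
  set s₂ := ⌊(q.c : ℝ) * q.space⌋₊ with hs₂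
  set s' := S + 3 + g * S + g * g + g + s₂ with hs'
  have hS3 : S ≤ (c + 3) * g ^ (3 * τ) := by
    have h1 : 4 + d + s ≤ (c + 3) * g ^ τ := by
      have : (c + 3) * g ^ τ = s + 3 * g ^ τ := by rw [hs]; ring
      omega
    calc S ≤ g ^ (2 * τ) * ((c + 3) * g ^ τ) := Nat.mul_le_mul_left _ h1
      _ = (c + 3) * g ^ (3 * τ) := by ring
  have hs'4 : S + 3 + g * S + g * g + g ≤ (2 * c + 12) * g ^ (4 * τ) := by
    have h1 : g ^ (3 * τ) ≤ g ^ (4 * τ) := Nat.pow_le_pow_right (by omega) (by omega)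
    have h2 : g * S ≤ (c + 3) * g ^ (4 * τ) := by
      calc g * S ≤ g ^ τ * ((c + 3) * g ^ (3 * τ)) := Nat.mul_le_mul hgτ hS3
        _ = (c + 3) * g ^ (4 * τ) := by ring
    have h3 : g * g ≤ g ^ (4 * τ) := by
      rw [← pow_two]
      exact Nat.pow_le_pow_right (by omega) (by omega)
    have h4 : g ≤ g ^ (4 * τ) := Nat.le_self_pow (by omega) _
    have h5 := hS3.trans (Nat.mul_le_mul_left _ h1)
    have h6 := hg1 (4 * τ)
    linarith
  have hspace : q.space = (q.Δ ^ τ) ^ 5 := q.space_eq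
  have hs'K : ((c : ℝ) + 1) * (s' : ℝ) ≤ K * q.space := by
    have h1 : ((g : ℝ) ^ (4 * τ)) ≤ 3 ^ (4 * T) * q.space := by
      calc (g : ℝ) ^ (4 * τ) ≤ (3 * q.Δ) ^ (4 * τ) := by gcongr
        _ = 3 ^ (4 * τ) * (q.Δ ^ τ) ^ 4 := by rw [mul_pow]; ring
        _ ≤ 3 ^ (4 * T) * (q.Δ ^ τ) ^ 5 := by
          gcongr
          · norm_num
          · exact one_le_pow₀ hΔ1
          · norm_num
        _ = _ := by rw [hspace]
    have h2 : (s₂ : ℝ) ≤ c * q.space := Nat.floor_le (mul_nonneg (by positivity) q.space_nonneg)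
    have h3 : ((S + 3 + g * S + g * g + g : ℕ) : ℝ) ≤ (2 * c + 12) * (g : ℝ) ^ (4 * τ) := by
      exact_mod_cast hs'4
    have h4 : (s' : ℝ) ≤ ((2 * c + 12) * 3 ^ (4 * T) + c) * q.space := by
      have h5 : (s' : ℝ) = ((S + 3 + g * S + g * g + g : ℕ) : ℝ) + s₂ := by
        rw [hs']; push_cast; ring
      rw [h5]
      have h6 : (2 * (c : ℝ) + 12) * (g : ℝ) ^ (4 * τ) ≤
          (2 * c + 12) * (3 ^ (4 * T) * q.space) := by gcongr
      linarith
    have h5 : (((c + 1) * ((2 * c + 12) * 3 ^ (4 * T) + c) : ℕ) : ℝ) ≤ K := by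
      exact_mod_cast (by omega)
    calc ((c : ℝ) + 1) * s' ≤ (c + 1) * (((2 * c + 12) * 3 ^ (4 * T) + c) * q.space) := by gcongr
      _ = (((c + 1) * ((2 * c + 12) * 3 ^ (4 * T) + c) : ℕ) : ℝ) * q.space := by push_cast; ring
      _ ≤ K * q.space := mul_le_mul_of_nonneg_right h5 q.space_nonneg
  -- Bounds by powers of `n + 2`.
  set X := n + 2 with hX
  have hX2 : 2 ≤ X := by omega
  have hpow : ∀ e, e ≤ X ^ e := fun e =>
    (Nat.lt_two_pow_self).le.trans (Nat.pow_le_pow_left hX2 e)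
  have hmono : ∀ {e e' : ℕ}, e ≤ e' → X ^ e ≤ X ^ e' := fun he =>
    Nat.pow_le_pow_right (by omega) he
  have hdouble : ∀ e, X ^ e + X ^ e ≤ X ^ (e + 1) := fun e => by
    rw [pow_succ]
    have := Nat.mul_le_mul_left (X ^ e) hX2
    omega
  have hX1 : ∀ e, 1 ≤ X ^ e := fun e => Nat.one_le_pow _ _ (by omega)
  have hseeds : X ^ E ≤ g ^ h := by
    rw [hh, pow_mul]
    exact Nat.pow_le_pow_left hgT E
  have hc1m : (c + 1) * m ≤ X ^ (c + 2) := by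
    calc (c + 1) * m ≤ X ^ (c + 1) * X := Nat.mul_le_mul (hpow _) (by omega)
      _ = X ^ (c + 2) := by ring
  have hXc : X ≤ X ^ (c + 1) := Nat.le_self_pow (by omega) _
  refine derandomizable_of_bounds (s := s) (W₀ := X ^ (c + 1)) (W := X ^ (c + h + 3)) (g := g)
    (h := h) (S := S) (s' := s') (D := D) hm hτ hk (by omega) (by omega) (by omega)
    (hmono (by omega)) (hmono (by simp [hq])) ?_ ?_ ?_ (by omega) ?_ ?_ (by omega) ?_ (by omega) ?_
    ?_ ?_ ?_ hA
  · have : q.Δ ^ τ ≤ (g : ℝ) ^ τ := by gcongr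
    rw [hs]
    push_cast
    exact mul_le_mul_of_nonneg_left this (by positivity)
  · exact Nat.mul_le_mul_right _ (Nat.pow_le_pow_left (by omega) _)
  · refine lt_of_lt_of_le ?_ hseeds
    have h1 : S ≤ X ^ (c + 3 + 3 * T) := by
      calc S ≤ (c + 3) * g ^ (3 * τ) := hS3
        _ ≤ X ^ (c + 3) * X ^ (3 * T) := Nat.mul_le_mul (hpow _)
          ((Nat.pow_le_pow_left hgn _).trans (hmono (by omega)))
        _ = _ := by ring
    have h2 : X ^ (c + 1) + 1 ≤ X ^ (c + 2) := by
      have := hdouble (c + 1)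
      have := hX1 (c + 1)
      exact le_trans (by omega) (hdouble (c + 1))
    have h3 : (X ^ (c + 1) + 1) * S ≤ X ^ (2 * c + 5 + 3 * T) := by
      calc _ ≤ X ^ (c + 2) * X ^ (c + 3 + 3 * T) := Nat.mul_le_mul h2 h1
        _ = _ := by ring
    have h4 : m + (X ^ (c + 1) + 1) * S ≤ X ^ (2 * c + 6 + 3 * T) := by
      have h5 : X ≤ X ^ (2 * c + 5 + 3 * T) := Nat.le_self_pow (by omega) _
      have h6 := hdouble (2 * c + 5 + 3 * T)
      have h7 : 2 * c + 5 + 3 * T + 1 = 2 * c + 6 + 3 * T := by omega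
      rw [h7] at h6
      omega
    have h5 : 6 ≤ X ^ 3 := le_trans (by norm_num) (Nat.pow_le_pow_left hX2 3)
    calc 6 * m * (m + (X ^ (c + 1) + 1) * S) ≤ X ^ 3 * X * X ^ (2 * c + 6 + 3 * T) :=
          Nat.mul_le_mul (Nat.mul_le_mul h5 (by omega)) h4
      _ = X ^ (2 * c + 10 + 3 * T) := by ring
      _ < X ^ E := Nat.pow_lt_pow_right (by omega) (by omega)
  · calc (c + 1) * m ≤ X ^ (c + 2) := hc1m
      _ ≤ (g ^ (T + 2)) ^ (c + 2) := Nat.pow_le_pow_left hgT _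
      _ = g ^ D := by rw [hD, pow_mul]
  · calc (c + 1) * m * g ^ h ≤ X ^ (c + 2) * X ^ h :=
          Nat.mul_le_mul hc1m (Nat.pow_le_pow_left hgn _)
      _ = X ^ (c + h + 2) := by ring
      _ < X ^ (c + h + 3) := Nat.pow_lt_pow_right (by omega) (by omega)
  · have : d * S ≤ g * S := Nat.mul_le_mul_right _ (by omega)
    change S + 3 + d * S ≤ s'
    omega
  · have : 1 * S ≤ g * S := Nat.mul_le_mul_right _ (by omega)
    omega
  · simp only [hK, hq]
    omega
  · have := hdouble (c + h + 3)
    have := hX1 (c + h + 3)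
    have h2 : X ^ (c + h + 3 + 1) ≤ X ^ K := hmono (by omega)
    exact le_trans (by omega) h2
  · exact hs'K

theorem mainTheorem2 :
    ∃ C : ℕ, ∀ δ : ℝ, 0 < δ → δ < 1 →
      ∀ P : GraphProblem, P.SelfReducible →
      ∀ (k τ : ℕ → ℕ) (c : ℕ),
        (∀ n, 1 ≤ k n) → (∀ n, 1 ≤ τ n) →
        (∀ ε : ℝ, 0 < ε → ∀ᶠ n : ℕ in Filter.atTop, (k n : ℝ) ≤ (n : ℝ) ^ ε) →
      ∀ A : (n m : ℕ) → List (Step m),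
        (∀ n m : ℕ, 1 ≤ m → m ≤ n → IsNormalAlgorithm P ⟨n, τ n, k n, c, C, δ⟩ (A n m)) →
      ∃ K : ℕ, ∀ n m : ℕ, 1 ≤ m → m ≤ n →
        ∃ (B : MPC m) (s : ℕ),
          B.rounds ≤ K * (k n * τ n + logStar m) ∧
          (s : ℝ) ≤ K * (n : ℝ) ^ (7 * δ * τ n * C) ∧
          (B.machines : ℝ) * s ≤ K * (m * (n : ℝ) ^ (7 * δ * τ n * C)) ∧
          ∀ (G : SimpleGraph (Fin m)) (IN : Fin m → List ℕ),
            MaxDegLE G ((n : ℝ) ^ (7 * δ)) → P.IsInstance G IN →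
            (∀ v, (Params.mk n (τ n) (k n) c C δ).Small (IN v)) →
            B.FitsSpace (nodeInput G (fun v => some (IN v))) s ((n + 2) ^ K) ∧
            P.IsSolution G IN (B.output (nodeInput G (fun v => some (IN v)))) := by
  refine ⟨5, fun δ hδ _ P _ k τ c hk hτ _ A hA => ?_⟩
  obtain ⟨K, hK⟩ := exists_derandomizable_of_lt δ hδ c
  refine ⟨K + 2 * (c + 3), fun n m hm hmn => ?_⟩
  suffices h : Derandomizable P ⟨n, τ n, k n, c, 5, δ⟩ m (K + 2 * (c + 3)) from h
  by_cases h : 7 * δ * τ n < 1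
  · exact (hK P n (τ n) (k n) m hm hmn (hτ n) (hk n) h _ (hA n m hm hmn)).mono (by omega)
  · refine (derandomizable_of_le (q := ⟨n, τ n, k n, c, 5, δ⟩) hm hmn (hτ n) (hk n) (by norm_num)
      ?_ (hA n m hm hmn)).mono (by simp)
    have hn : (1 : ℝ) ≤ n := by exact_mod_cast hm.trans hmn
    calc (n : ℝ) = (n : ℝ) ^ (1 : ℝ) := (Real.rpow_one _).symm
      _ ≤ (n : ℝ) ^ (7 * δ * τ n) := Real.rpow_le_rpow_of_exponent_le hn (not_lt.1 h)
      _ = _ := by rw [Real.rpow_mul (by positivity), Real.rpow_natCast]; rfl
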